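/- For $k\ge 0$ let $\nu(k)=4k+2$ and let $$e_k(x)=\frac1{\sqrt\pi}\,\mathcal L_k(|x|^2)\quad(x\in\mathbb R^2),\qquad \mathcal L_k(z)=\frac{e^{z/2}}{k!}\frac{d^k}{dz^k}\bigl(z^ke^{-z}\bigr),$$ be the radial Hermite eigenfunctions, i.e. the $L^2$-normalized radial eigenfunctions of $-\Delta+|x|^2$ on $\mathbb R^2$, with eigenvalue $\nu(k)$. (1) For $2\le q\le\infty$ put $\rho(q)=\min\{\frac12-\frac1q,\frac1q\}$ (with $\frac1\infty=0$). For every $q\in[2,\infty]$ with $q\ne 4$ there is a constant $C=C(q)>0$ such that for all $k\ge0$ $$\|e_k\|_{L^q(\mathbb R^2)}\le C\,\nu(k)^{-\rho(q)}.$$ Moreover, there is a constant $C>0$ such that for all $k\ge 0$ $$\|e_k\|_{L^4(\mathbb R^2)}\le C\,\nu(k)^{-1/4}(\log\nu(k))^{1/4}.$$ (2) Let $l\ge4$. For $n_1,\dots,n_l\ge0$ write $\nu_j=\nu(n_j)$; the product $e_{n_1}\cdots e_{n_l}$ is integrable on $\mathbb R^2$. For every $A>0$ there is a constant $C=C(l,A)>0$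 such that, for all $n_1,\dots,n_l\ge0$ with $\nu_{j+1}\le A\nu_j$ for $1\le j<l$, $$\Bigl|\int_{\mathbb R^2}e_{n_1}(x)\cdots e_{n_l}(x)\,dx\Bigr|\le C\,\nu_1^{-1/2}\nu_3^{-1/4}\log\nu_1 .$$ Moreover, for all $A,B,\varepsilon,N>0$ there is a constant $C=C(l,A,B,\varepsilon,N)>0$ such that, for all $n_1,\dots,n_l\ge0$ with $\nu_{j+1}\le A\nu_j$ for $1\le j<l$ and $\nu_2^{1+\varepsilon}\le B\nu_1$, $$\Bigl|\int_{\mathbb R^2}e_{n_1}(x)\cdots e_{n_l}(x)\,dx\Bigr|\le C\,\nu_1^{-N}.$$ -/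

import Mathlib

noncomputable section

namespace RadialHermite

/-- The Laguerre function of order zero,
`(exp (z / 2) / k!) * (d / dz) ^ k (z ^ k * exp (-z))`. -/
def laguerreFun (k : ℕ) (z : ℝ) : ℝ :=
  Real.exp (z / 2) / (Nat.factorial k : ℝ) *
    iteratedDeriv k (fun t : ℝ => t ^ k * Real.exp (-t)) z

/-- The radial Hermite eigenfunction `e_k` on the Euclidean plane. -/
def e (k : ℕ) (x : EuclideanSpace ℝ (Fin 2)) : ℝ :=
  1 / Real.sqrt Real.pi * laguerreFun k (‖x‖ ^ 2)

/-- The eigenvalue `4 k + 2` of `-Δ + |x| ^ 2` belonging to `e_k`. -/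
def ν (k : ℕ) : ℝ := 4 * (k : ℝ) + 2

/-- The exponent `min (1 / 2 - 1 / q) (1 / q)`, where `1 / ∞ = 0`. -/
def ρ (q : ENNReal) : ℝ := min (1 / 2 - (q⁻¹).toReal) (q⁻¹).toReal

/-- `ν_{n_1} ≳ ν_{n_2} ≳ ⋯ ≳ ν_{n_l}`, where each `≳` has the implied constant `A`. -/
def AlmostDecreasing (A : ℝ) {l : ℕ} (n : Fin l → ℕ) : Prop :=
  ∀ (i : ℕ) (hi : i + 1 < l), ν (n ⟨i + 1, hi⟩) ≤ A * ν (n ⟨i, Nat.lt_of_succ_lt hi⟩)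

end RadialHermite

end

/-!
Write `ℓ_k (z) = exp (-z / 2) L_k (z)`. The map `x ↦ ‖x‖ ^ 2` pushes Lebesgue measure on the plane
forward to `π` times Lebesgue measure on the half-line, so everything is a statement about the
functions `ℓ_k` on `(0, ∞)`.

**Norms.** The equation `(z ℓ')' = -((ν - z) / 4) ℓ` admits a quadratic form in `(ℓ, z ℓ')` whose
derivative is a multiple of `ℓ ^ 2`. With the weight `(z (ν + b - z)) ^ (-1 / 2)`, where
`b = 3 ν ^ (1 / 3)`, that multiple is nonpositive on all of `(0, ν]` (`energy_antitone`), while the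
form stays uniformly definite up to and including the turning point (`discriminant_lower`). As the
form is bounded at `z = 1 / ν`, this yields `ℓ ^ 4 ≤ C / (z (ν + b - z))` on `(0, ν]`
(`laguerreFun_pow_four_le`). Past `ν` the square `ℓ ^ 2` decreases, and integrating the identity
`(z ℓ ℓ')' = z ℓ' ^ 2 + ((z - ν) / 4) ℓ ^ 2` gives `|ℓ| ≤ C / (ν ^ (1 / 3) + z - ν)`
(`abs_laguerreFun_le_tail`). The bounds on the norms follow by integrating these majorants.

**Products.** For a complex `S` with `Re S ≥ 0`, the Laplace transform is
`∫ exp (-S z / 2) ℓ_n = 2 / (S + 1) * ((S - 1) / (S + 1)) ^ n`, and the generating function is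
`∑ ℓ_k t ^ k = exp (-s z / 2) / (1 - t)` with `s = (1 + t) / (1 - t)`. Replacing all factors but
the first by Cauchy integrals over `|t| = 1 - 1 / O(ν₂)` turns the integral of the product into an
average of Laplace transforms at sums of points `s`. Those sums lie in a disc on which
`|(S - 1) / (S + 1)| ≤ 1 - c / ν₂` (`norm_cayley_sub`, `norm_sub_one_le`), so the integral is at most
`C ν₂ ^ (l - 1) exp (-c ν₁ / ν₂)` (`abs_integral_prod_le_exp`). This gives the rapid decay for
separated frequencies, and reduces the general bound to the range `ν₁ / ν₂ ≲ log ν₁`, where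
Hölder's inequality and the `L ^ 4` bound suffice.
-/

namespace RadialHermite

open MeasureTheory Set

/-! ### Laguerre functions and their differential equation -/

open Polynomial in
/-- The Laguerre polynomial `L_k` of order zero, given by its coefficients. -/
noncomputable def lagPoly (k : ℕ) : ℝ[X] :=
  ∑ j ∈ Finset.range (k + 1), monomial j ((-1 : ℝ) ^ j * (k.choose j : ℝ) / (j.factorial : ℝ))

lemma lagPoly_coeff (k j : ℕ) :
    (lagPoly k).coeff j = (-1 : ℝ) ^ j * (k.choose j : ℝ) / (j.factorial : ℝ) := by
  simp only [lagPoly, Polynomial.finsetSum_coeff, Polynomial.coeff_monomial]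
  rw [Finset.sum_ite_eq']
  split_ifs with h
  · rfl
  · rw [Nat.choose_eq_zero_of_lt (by simpa using h)]; simp

lemma lagPoly_eval (k : ℕ) (z : ℝ) : (lagPoly k).eval z =
    ∑ j ∈ Finset.range (k + 1), (k.choose j : ℝ) * (-z) ^ j / (j.factorial : ℝ) := by
  simp only [lagPoly, Polynomial.eval_finsetSum, Polynomial.eval_monomial]
  refine Finset.sum_congr rfl fun j _ => ?_
  rw [neg_pow z]; ring

/-- Rodrigues' formula. -/
lemma laguerreFun_eq (k : ℕ) (z : ℝ) :
    laguerreFun k z = Real.exp (-z / 2) * (lagPoly k).eval z := by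
  have hg : ∀ (i : ℕ), iteratedDeriv i (fun t : ℝ => Real.exp (-t)) z =
      (-1) ^ i * Real.exp (-z) := by
    intro i
    simp [iteratedDeriv_comp_neg i Real.exp z, iteratedDeriv_eq_iterate]
  unfold laguerreFun
  rw [iteratedDeriv_fun_mul (by fun_prop) (by fun_prop), lagPoly_eval,
    ← Finset.sum_range_reflect, Finset.mul_sum, Finset.mul_sum]
  refine Finset.sum_congr rfl fun i hi => ?_
  have hi' : i ≤ k := by simpa [Nat.lt_succ_iff] using hi
  have e1 : k + 1 - 1 - i = k - i := by omega
  rw [e1, hg, iteratedDeriv_pow, Nat.sub_sub_self hi', Nat.choose_symm hi',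
    neg_pow z, neg_div, Real.exp_neg (z / 2)]
  have h3 : Real.exp (-z) = (Real.exp (z / 2))⁻¹ * (Real.exp (z / 2))⁻¹ := by
    rw [← Real.exp_neg, ← Real.exp_add]; congr 1; ring
  have h4 : (k.descFactorial (k - i) : ℝ) * (i.factorial : ℝ) = k.factorial := by
    have := Nat.factorial_mul_descFactorial (Nat.sub_le k i)
    rw [Nat.sub_sub_self hi'] at this
    rw [mul_comm]; exact_mod_cast this
  have h5 : (i.factorial : ℝ) ≠ 0 := by positivity
  have h6 : (k.factorial : ℝ) ≠ 0 := by positivity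
  rw [h3]
  field_simp
  rw [← h4]
  ring

/-- The function `z ↦ z * (d / dz) (laguerreFun k) z`. -/
noncomputable def laguerreTheta (k : ℕ) (z : ℝ) : ℝ :=
  z * (Real.exp (-z / 2) * ((lagPoly k).derivative.eval z - (lagPoly k).eval z / 2))

lemma laguerre_ode (k : ℕ) : Polynomial.X * (lagPoly k).derivative.derivative
    + (1 - Polynomial.X) * (lagPoly k).derivative + Polynomial.C (k : ℝ) * lagPoly k = 0 := by
  have key : ∀ j : ℕ, ((j : ℝ) + 1) ^ 2 * (lagPoly k).coeff (j + 1) =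
      ((j : ℝ) - k) * (lagPoly k).coeff j := by
    intro j
    rw [lagPoly_coeff, lagPoly_coeff, Nat.factorial_succ]
    have h1 : ((k.choose (j + 1) : ℝ)) * (j + 1) = k.choose j * (k - j) := by
      rcases le_or_gt j k with h | h
      · have := Nat.choose_succ_right_eq k j
        rw [← Nat.cast_sub h]; exact_mod_cast this
      · rw [Nat.choose_eq_zero_of_lt h, Nat.choose_eq_zero_of_lt (by omega)]; simp
    have h5 : (j.factorial : ℝ) ≠ 0 := by positivity
    have h6 : (j : ℝ) + 1 ≠ 0 := by positivity
    push_cast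
    rw [pow_succ]
    field_simp
    linear_combination (-(-1 : ℝ) ^ j) * h1
  ext j
  rw [sub_mul, one_mul]
  cases j with
  | zero =>
    have := key 0
    simp [Polynomial.coeff_derivative] at this ⊢
    linarith
  | succ j =>
    have := key (j + 1)
    simp only [Polynomial.coeff_add, Polynomial.coeff_sub, Polynomial.coeff_X_mul,
      Polynomial.coeff_derivative, Polynomial.coeff_C_mul, Polynomial.coeff_zero]
    push_cast at this ⊢
    linarith

lemma hasDerivAt_exp_half (z : ℝ) :
    HasDerivAt (fun z : ℝ => Real.exp (-z / 2)) (Real.exp (-z / 2) * (-1 / 2)) z := by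
  have := ((hasDerivAt_id z).neg.div_const 2).exp
  simpa using this

lemma hasDerivAt_laguerreFun' (k : ℕ) (z : ℝ) : HasDerivAt (laguerreFun k)
    (Real.exp (-z / 2) * ((lagPoly k).derivative.eval z - (lagPoly k).eval z / 2)) z := by
  have h := (hasDerivAt_exp_half z).mul ((lagPoly k).hasDerivAt z)
  have e1 : laguerreFun k = fun z => Real.exp (-z / 2) * (lagPoly k).eval z :=
    funext (laguerreFun_eq k)
  rw [e1]
  refine h.congr_deriv ?_
  ring

lemma hasDerivAt_laguerreFun (k : ℕ) {z : ℝ} (hz : z ≠ 0) :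
    HasDerivAt (laguerreFun k) (laguerreTheta k z / z) z := by
  refine (hasDerivAt_laguerreFun' k z).congr_deriv ?_
  unfold laguerreTheta
  field_simp

/-- The Laguerre functions solve `(z f')' = -((ν - z) / 4) f`. -/
lemma hasDerivAt_laguerreTheta (k : ℕ) (z : ℝ) :
    HasDerivAt (laguerreTheta k) (-((ν k - z) / 4) * laguerreFun k z) z := by
  have h := (hasDerivAt_id z).mul ((hasDerivAt_exp_half z).mul
    (((lagPoly k).derivative.hasDerivAt z).sub (((lagPoly k).hasDerivAt z).div_const 2)))
  refine h.congr_deriv ?_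
  have ode := congrArg (Polynomial.eval z) (laguerre_ode k)
  simp only [Polynomial.eval_add, Polynomial.eval_mul, Polynomial.eval_sub, Polynomial.eval_X,
    Polynomial.eval_one, Polynomial.eval_C, Polynomial.eval_zero] at ode
  rw [laguerreFun_eq, ν]
  simp only [id, Pi.mul_apply, Pi.sub_apply]
  linear_combination (Real.exp (-z / 2)) * ode

lemma continuous_laguerreFun (k : ℕ) : Continuous (laguerreFun k) :=
  continuous_iff_continuousAt.2 fun z => (hasDerivAt_laguerreFun' k z).continuousAt

lemma continuous_laguerreTheta (k : ℕ) : Continuous (laguerreTheta k) :=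
  continuous_iff_continuousAt.2 fun z => (hasDerivAt_laguerreTheta k z).continuousAt

lemma two_le_ν (k : ℕ) : 2 ≤ ν k := by
  have : (0 : ℝ) ≤ k := Nat.cast_nonneg k
  unfold ν; linarith

lemma ν_pos (k : ℕ) : 0 < ν k := by linarith [two_le_ν k]

/-- Products of a polynomial with `exp (-a z)`, `a > 0`, tend to zero at infinity. -/
lemma tendsto_poly_mul_exp (p : Polynomial ℝ) {a : ℝ} (ha : 0 < a) :
    Filter.Tendsto (fun z : ℝ => p.eval z * Real.exp (-a * z)) Filter.atTop (nhds 0) := by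
  simp_rw [Polynomial.eval_eq_sum_range, Finset.sum_mul]
  rw [← Finset.sum_const_zero (s := Finset.range (p.natDegree + 1))]
  refine tendsto_finsetSum _ fun i _ => ?_
  have := (tendsto_rpow_mul_exp_neg_mul_atTop_nhds_zero (i : ℝ) a ha).const_mul (p.coeff i)
  simp only [Real.rpow_natCast, mul_zero] at this
  simpa [mul_assoc] using this

lemma tendsto_laguerreFun (k : ℕ) :
    Filter.Tendsto (laguerreFun k) Filter.atTop (nhds 0) := by
  refine (tendsto_poly_mul_exp (lagPoly k) (a := 1 / 2) (by norm_num)).congr fun z => ?_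
  rw [laguerreFun_eq, mul_comm]; congr 2; ring

lemma tendsto_laguerreTheta (k : ℕ) :
    Filter.Tendsto (laguerreTheta k) Filter.atTop (nhds 0) := by
  refine (tendsto_poly_mul_exp (Polynomial.X * ((lagPoly k).derivative -
    Polynomial.C (1 / 2) * lagPoly k)) (a := 1 / 2) (by norm_num)).congr fun z => ?_
  simp only [laguerreTheta, Polynomial.eval_mul, Polynomial.eval_X, Polynomial.eval_sub,
    Polynomial.eval_C]
  have : -(1 / 2) * z = -z / 2 := by ring
  rw [this]; ring

lemma abs_laguerreFun_le_near_zero (k : ℕ) {z : ℝ} (hz : 0 ≤ z) (hz' : z ≤ 1 / ν k) :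
    |laguerreFun k z| ≤ 2 := by
  have hν := ν_pos k
  have hk : (k : ℝ) * z ≤ 1 / 4 := by
    have h1 : ν k * z ≤ 1 := by
      calc ν k * z ≤ ν k * (1 / ν k) := by gcongr
        _ = 1 := by field_simp
    unfold ν at h1
    nlinarith
  have h1 : |(lagPoly k).eval z| ≤ Real.exp (k * z) := by
    rw [lagPoly_eval]
    refine (Finset.abs_sum_le_sum_abs _ _).trans ?_
    refine le_trans ?_ (Real.sum_le_exp_of_nonneg (by positivity) (k + 1))
    refine Finset.sum_le_sum fun j _ => ?_
    rw [abs_div, abs_mul, abs_pow, abs_neg, abs_of_nonneg hz, Nat.abs_cast, Nat.abs_cast, mul_pow]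
    gcongr
    exact_mod_cast Nat.choose_le_pow k j
  have h2 : Real.exp (k * z) ≤ 2 := by
    calc Real.exp (k * z) ≤ Real.exp (Real.log 2) :=
          Real.exp_le_exp.2 (hk.trans (by linarith [Real.log_two_gt_d9]))
      _ = 2 := Real.exp_log (by norm_num)
  rw [laguerreFun_eq, abs_mul, abs_of_pos (Real.exp_pos _)]
  have h3 : Real.exp (-z / 2) ≤ 1 := Real.exp_le_one_iff.2 (by linarith)
  calc _ ≤ 1 * |(lagPoly k).eval z| := by gcongr
    _ ≤ 2 := by linarith

lemma abs_laguerreTheta_le_near_zero (k : ℕ) :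
    |laguerreTheta k (1 / ν k)| ≤ 1 / 2 := by
  have hν := ν_pos k
  have hz : (0 : ℝ) ≤ 1 / ν k := by positivity
  have h := norm_image_sub_le_of_norm_deriv_le_segment' (f := laguerreTheta k)
    (a := 0) (b := 1 / ν k) (C := ν k / 2)
    (fun x _ => (hasDerivAt_laguerreTheta k x).hasDerivWithinAt) (by
      intro x hx
      have h1 := abs_laguerreFun_le_near_zero k hx.1 hx.2.le
      have h2 := two_le_ν k
      have h3 : x ≤ ν k := by
        refine hx.2.le.trans ?_
        rw [div_le_iff₀ hν]; nlinarith
      rw [Real.norm_eq_abs, abs_mul, abs_neg, abs_of_nonneg (by linarith)]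
      calc _ ≤ (ν k) / 4 * 2 := by
            gcongr; linarith [hx.1]
        _ = ν k / 2 := by ring) (1 / ν k) ⟨hz, le_rfl⟩
  have h0 : laguerreTheta k 0 = 0 := by simp [laguerreTheta]
  rw [h0, sub_zero, sub_zero, Real.norm_eq_abs] at h
  calc _ ≤ _ := h
    _ = 1 / 2 := by field_simp

/-! ### The energy up to the turning point -/

/-- The width `b = 3 ν ^ (1 / 3)` of the transition zone at the turning point `z = ν`. -/
noncomputable def width (k : ℕ) : ℝ := 3 * ν k ^ (1 / 3 : ℝ)

lemma width_cube (k : ℕ) : width k ^ 3 = 27 * ν k := by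
  have h : (ν k ^ (1 / 3 : ℝ)) ^ 3 = ν k := by
    rw [← Real.rpow_natCast, ← Real.rpow_mul (ν_pos k).le]; norm_num
  rw [width, mul_pow, h]; norm_num

lemma width_pos (k : ℕ) : 0 < width k := by
  have := Real.rpow_pos_of_pos (ν_pos k) (1 / 3 : ℝ)
  unfold width; linarith

lemma three_le_width (k : ℕ) : 3 ≤ width k := by
  have := Real.one_le_rpow (by linarith [two_le_ν k] : 1 ≤ ν k) (by norm_num : (0 : ℝ) ≤ 1 / 3)
  unfold width; linarith

lemma width_sq_ge (k : ℕ) : 27 / 2 ≤ width k ^ 2 := by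
  have h1 := width_cube k
  have h2 := two_le_ν k
  by_contra! h
  have h3 : width k < 4 := by nlinarith [width_pos k]
  nlinarith [width_pos k]

lemma width_le (k : ℕ) : width k ≤ 2 * ν k := by
  have h1 := width_cube k
  have h2 := width_sq_ge k
  nlinarith [width_pos k]

/-- The weight `(z (ν + b - z)) ^ (-1 / 2)` of the energy. -/
noncomputable def weight (k : ℕ) (z : ℝ) : ℝ := (√(z * (ν k + width k - z)))⁻¹

/-- The ratio `y = z / (ν + b - z)`; it satisfies `z * (d / dz) y = y * (1 + y)`. -/
noncomputable def ratio (k : ℕ) (z : ℝ) : ℝ := z / (ν k + width k - z)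

lemma weight_pos (k : ℕ) {z : ℝ} (hz : 0 < z) (hz' : z < ν k + width k) : 0 < weight k z := by
  unfold weight
  have : 0 < z * (ν k + width k - z) := mul_pos hz (by linarith)
  positivity

lemma weight_sq (k : ℕ) {z : ℝ} (hz : 0 < z) (hz' : z < ν k + width k) :
    weight k z ^ 2 = 1 / (z * (ν k + width k - z)) := by
  have : 0 < z * (ν k + width k - z) := mul_pos hz (by linarith)
  rw [weight, inv_pow, Real.sq_sqrt this.le, one_div]

lemma hasDerivAt_ratio (k : ℕ) {z : ℝ} (hz : 0 < z) (hz' : z < ν k + width k) :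
    HasDerivAt (ratio k) (ratio k z * (1 + ratio k z) / z) z := by
  have hX : ν k + width k - z ≠ 0 := by linarith
  have h := (hasDerivAt_id z).div ((hasDerivAt_const z (ν k + width k)).sub (hasDerivAt_id z)) hX
  refine h.congr_deriv ?_
  unfold ratio
  simp only [id, Pi.sub_apply]
  field_simp
  ring

lemma hasDerivAt_weight (k : ℕ) {z : ℝ} (hz : 0 < z) (hz' : z < ν k + width k) :
    HasDerivAt (weight k) (weight k z * (ratio k z - 1) / (2 * z)) z := by
  have hX : 0 < ν k + width k - z := by linarith
  have hp : 0 < z * (ν k + width k - z) := mul_pos hz hX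
  have h := (((hasDerivAt_id z).mul
    ((hasDerivAt_const z (ν k + width k)).sub (hasDerivAt_id z))).sqrt (by exact hp.ne')).inv
    (by exact (Real.sqrt_pos.2 hp).ne')
  refine h.congr_deriv ?_
  unfold weight ratio
  simp only [id, Pi.sub_apply, Pi.mul_apply]
  have hs : √(z * (ν k + width k - z)) ≠ 0 := (Real.sqrt_pos.2 hp).ne'
  rw [Real.sq_sqrt hp.le]
  field_simp
  ring

/-- The energy: a quadratic form in `(f, z f')`, positive up to the turning point, with the
coefficients for which the derivative is a multiple of `f ^ 2` alone. -/
noncomputable def energy (k : ℕ) (z : ℝ) : ℝ :=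
  weight k z * ((z * (ν k - z) / 4 + (3 * ratio k z ^ 2 + 1) / 8) * laguerreFun k z ^ 2 +
    (1 - ratio k z) / 2 * (laguerreFun k z * laguerreTheta k z) + laguerreTheta k z ^ 2)

/-- The coefficients of `f * (z f')` and `(z f') ^ 2` in the derivative of the energy vanish. -/
lemma hasDerivAt_energy (k : ℕ) {z : ℝ} (hz : 0 < z) (hz' : z < ν k + width k) :
    HasDerivAt (energy k) (weight k z / z * (-(width k * z * ratio k z) / 4 +
      (15 * ratio k z ^ 3 + 9 * ratio k z ^ 2 + ratio k z - 1) / 16) * laguerreFun k z ^ 2) z := by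
  have hX : 0 < ν k + width k - z := by linarith
  have hf := hasDerivAt_laguerreFun k hz.ne'
  have hg := hasDerivAt_laguerreTheta k z
  have hw := hasDerivAt_weight k hz hz'
  have hr := hasDerivAt_ratio k hz hz'
  have hQ : HasDerivAt (fun z => z * (ν k - z) / 4) ((ν k - 2 * z) / 4) z := by
    have := ((hasDerivAt_id z).mul ((hasDerivAt_const z (ν k)).sub (hasDerivAt_id z))).div_const 4
    refine this.congr_deriv ?_
    simp only [id, Pi.sub_apply]; ring
  have h := hw.mul ((((hQ.add ((((hr.pow 2).const_mul 3).add_const 1).div_const 8)).mul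
    (hf.pow 2)).add (((hr.const_sub 1).div_const 2).mul (hf.mul hg))).add (hg.pow 2))
  refine h.congr_deriv ?_
  simp only [Pi.mul_apply, Pi.add_apply, Pi.pow_apply]
  have hb : width k = z / ratio k z + z - ν k := by
    unfold ratio; field_simp; ring
  have hr0 : ratio k z ≠ 0 := by unfold ratio; positivity
  rw [hb]
  generalize weight k z = γ
  generalize ratio k z = y at *
  generalize laguerreFun k z = f
  generalize laguerreTheta k z = g
  field_simp
  ring

/-- Monotonicity extends up to the turning point `z = ν` itself. -/
lemma energy_antitone (k : ℕ) : AntitoneOn (energy k) (Set.Icc (1 / ν k) (ν k)) := by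
  have hν := ν_pos k
  have hb := width_pos k
  have h0 : 0 < 1 / ν k := by positivity
  have hder : ∀ z ∈ Set.Icc (1 / ν k) (ν k), HasDerivAt (energy k) _ z := fun z hz =>
    hasDerivAt_energy k (h0.trans_le hz.1) (by linarith [hz.2])
  refine antitoneOn_of_deriv_nonpos (convex_Icc _ _)
    (fun z hz => (hder z hz).continuousAt.continuousWithinAt) (fun z hz =>
      (hder z (interior_subset hz)).differentiableAt.differentiableWithinAt) fun z hz => ?_
  have hz1 := interior_subset hz
  rw [(hder z hz1).deriv]
  have hz0 : 0 < z := h0.trans_le hz1.1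
  have hX : width k ≤ ν k + width k - z := by linarith [hz1.2]
  have hX0 : 0 < ν k + width k - z := by linarith
  have hw := weight_pos k hz0 (by linarith : z < ν k + width k)
  have hy : 0 < ratio k z := by unfold ratio; positivity
  have hyX : ratio k z * (ν k + width k - z) = z := by unfold ratio; field_simp
  have hyb : ratio k z * width k ≤ z := by
    calc _ ≤ ratio k z * (ν k + width k - z) := by gcongr
      _ = z := hyX
  -- `b ^ 3 = 27 ν` makes `b z` dominate the terms coming from the third derivative of the weight
  have main : 15 * ratio k z ^ 2 + 10 * ratio k z ≤ 4 * width k * z := by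
    have h1 : ratio k z * width k ^ 3 ≤ z * (width k) ^ 2 := by nlinarith
    have hyν : ratio k z * width k ≤ ν k := hyb.trans hz1.2
    have h2 : 15 * ratio k z ^ 2 ≤ 3 * width k * z := by
      have : 27 * ratio k z ≤ width k ^ 2 := by
        have := width_cube k
        nlinarith
      nlinarith
    have h3 : 10 * ratio k z ≤ width k * z := by
      have := width_sq_ge k
      nlinarith
    linarith
  have hS : -(width k * z * ratio k z) / 4 +
      (15 * ratio k z ^ 3 + 9 * ratio k z ^ 2 + ratio k z - 1) / 16 ≤ 0 := by
    have h4 : ratio k z - 1 ≤ ratio k z ^ 2 := by nlinarith [sq_nonneg (ratio k z - 1)]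
    have h5 : 15 * ratio k z ^ 3 + 10 * ratio k z ^ 2 ≤ 4 * width k * z * ratio k z := by
      nlinarith
    linarith
  have : 0 ≤ weight k z / z := by positivity
  exact mul_nonpos_of_nonpos_of_nonneg (mul_nonpos_of_nonneg_of_nonpos this hS) (sq_nonneg _)

lemma energy_start_le (k : ℕ) : energy k (1 / ν k) ≤ 4 := by
  have hν := two_le_ν k
  have hν0 := ν_pos k
  have hb := three_le_width k
  set z : ℝ := 1 / ν k with hz
  have hz0 : 0 < z := by positivity
  have hzν : z * ν k = 1 := by rw [hz]; field_simp
  have hz1 : z ≤ 1 / 2 := by rw [hz]; gcongr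
  have hX : ν k ≤ ν k + width k - z := by linarith
  have hX0 : 0 < ν k + width k - z := by linarith
  have hp : 1 ≤ z * (ν k + width k - z) := by nlinarith
  have hw : weight k z ≤ 1 := by
    unfold weight
    exact inv_le_one_of_one_le₀ (Real.one_le_sqrt.2 hp)
  have hw0 := weight_pos k hz0 (by linarith : z < ν k + width k)
  have hy0 : 0 < ratio k z := by unfold ratio; positivity
  have hy1 : ratio k z ≤ 1 := by
    unfold ratio; rw [div_le_one hX0]; linarith
  have hf := abs_laguerreFun_le_near_zero k hz0.le hz.le
  have hg := abs_laguerreTheta_le_near_zero k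
  rw [← hz] at hg
  have hf2 : laguerreFun k z ^ 2 ≤ 4 := by
    rw [← sq_abs]; nlinarith [abs_nonneg (laguerreFun k z)]
  have hg2 : laguerreTheta k z ^ 2 ≤ 1 / 4 := by
    rw [← sq_abs]; nlinarith [abs_nonneg (laguerreTheta k z)]
  have hfg : laguerreFun k z * laguerreTheta k z ≤ 1 := by
    refine (le_abs_self _).trans ?_
    rw [abs_mul]
    nlinarith [abs_nonneg (laguerreTheta k z), abs_nonneg (laguerreFun k z)]
  have hQ : z * (ν k - z) / 4 + (3 * ratio k z ^ 2 + 1) / 8 ≤ 3 / 4 := by nlinarith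
  have hQ0 : 0 ≤ z * (ν k - z) / 4 + (3 * ratio k z ^ 2 + 1) / 8 := by nlinarith
  have hB : (z * (ν k - z) / 4 + (3 * ratio k z ^ 2 + 1) / 8) * laguerreFun k z ^ 2 +
      (1 - ratio k z) / 2 * (laguerreFun k z * laguerreTheta k z) + laguerreTheta k z ^ 2 ≤ 4 := by
    have h1 : (z * (ν k - z) / 4 + (3 * ratio k z ^ 2 + 1) / 8) * laguerreFun k z ^ 2 ≤
      3 / 4 * 4 := by gcongr
    have h2 : (1 - ratio k z) / 2 * (laguerreFun k z * laguerreTheta k z) ≤ 1 / 2 * 1 := by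
      calc _ ≤ (1 - ratio k z) / 2 * 1 := by gcongr
        _ ≤ _ := by linarith
    linarith
  unfold energy
  calc _ ≤ weight k z * 4 := by gcongr
    _ ≤ 4 := by linarith

lemma energy_le (k : ℕ) {z : ℝ} (hz : 1 / ν k ≤ z) (hz' : z ≤ ν k) : energy k z ≤ 4 :=
  (energy_antitone k ⟨le_rfl, hz.trans hz'⟩ ⟨hz, hz'⟩ hz).trans (energy_start_le k)

/-- The discriminant of the energy is bounded below uniformly up to the turning point. -/
lemma discriminant_lower (k : ℕ) {z : ℝ} (hz : 0 < z) (hz' : z ≤ ν k) :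
    1 / 1500 ≤ weight k z ^ 2 *
      (z * (ν k - z) / 4 + (5 * ratio k z ^ 2 + 2 * ratio k z + 1) / 16) := by
  have hν := ν_pos k
  have hb := width_pos k
  have hX0 : 0 < ν k + width k - z := by linarith
  have hy0 : 0 < ratio k z := by unfold ratio; positivity
  rw [weight_sq k hz (by linarith)]
  by_cases h : ν k + width k - z ≤ 5 * (ν k - z)
  · have h1 : 1 / 20 ≤ 1 / (z * (ν k + width k - z)) * (z * (ν k - z) / 4) := by
      rw [one_div_mul_eq_div, div_le_div_iff₀ (by norm_num) (by positivity)]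
      nlinarith
    have h2 : 0 ≤ 1 / (z * (ν k + width k - z)) *
      ((5 * ratio k z ^ 2 + 2 * ratio k z + 1) / 16) := by positivity
    rw [mul_add]; linarith
  · push Not at h
    -- within `O(b)` of the turning point `ν - z` may vanish, and only the term `y ^ 2` is left
    have h3 : ν k / 2 ≤ z := by linarith [width_le k]
    have h4 : ν k + width k - z ≤ 2 * width k := by linarith
    have h5 : 1 / 1500 ≤ 1 / (z * (ν k + width k - z)) * (5 * ratio k z ^ 2 / 16) := by
      have e1 : 1 / (z * (ν k + width k - z)) * (5 * ratio k z ^ 2 / 16) =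
        5 * z / (16 * (ν k + width k - z) ^ 3) := by
        unfold ratio; field_simp
      rw [e1, div_le_div_iff₀ (by norm_num) (by positivity)]
      have h6 : (ν k + width k - z) ^ 3 ≤ (2 * width k) ^ 3 := by gcongr
      have := width_cube k
      nlinarith
    refine h5.trans ?_
    gcongr
    have : 0 ≤ z * (ν k - z) := mul_nonneg hz.le (by linarith)
    linarith

lemma laguerreFun_sq_le (k : ℕ) {z : ℝ} (hz : 1 / ν k ≤ z) (hz' : z ≤ ν k) :
    laguerreFun k z ^ 2 ≤ 6000 * weight k z := by
  have hν := ν_pos k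
  have h0 : 0 < 1 / ν k := by positivity
  have hz0 : 0 < z := h0.trans_le hz
  have hw := weight_pos k hz0 (by linarith [width_pos k] : z < ν k + width k)
  have hE := energy_le k hz hz'
  have hD := discriminant_lower k hz0 hz'
  have h1 : laguerreFun k z ^ 2 * (weight k z ^ 2 *
      (z * (ν k - z) / 4 + (5 * ratio k z ^ 2 + 2 * ratio k z + 1) / 16)) ≤
      weight k z * energy k z := by
    have : weight k z * energy k z = weight k z ^ 2 *
      ((laguerreTheta k z + (1 - ratio k z) / 4 * laguerreFun k z) ^ 2 +
      (z * (ν k - z) / 4 + (5 * ratio k z ^ 2 + 2 * ratio k z + 1) / 16)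
        * laguerreFun k z ^ 2) := by
      unfold energy; ring
    rw [this]
    nlinarith [mul_nonneg (sq_nonneg (weight k z))
      (sq_nonneg (laguerreTheta k z + (1 - ratio k z) / 4 * laguerreFun k z))]
  have h2 : laguerreFun k z ^ 2 * (1 / 1500) ≤ weight k z * 4 := by
    calc _ ≤ _ := mul_le_mul_of_nonneg_left hD (sq_nonneg _)
      _ ≤ _ := h1
      _ ≤ _ := by gcongr
  linarith

/-- The pointwise bound up to the turning point, of the size predicted by the WKB method. -/
lemma laguerreFun_pow_four_le (k : ℕ) {z : ℝ} (hz : 0 ≤ z) (hz' : z ≤ ν k) :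
    laguerreFun k z ^ 4 * (z * (ν k + width k - z)) ≤ 6000 ^ 2 := by
  have hν := ν_pos k
  have hb := width_pos k
  have hf4 : laguerreFun k z ^ 4 = (laguerreFun k z ^ 2) ^ 2 := by ring
  rcases le_total z (1 / ν k) with h | h
  · have hf := abs_laguerreFun_le_near_zero k hz h
    have hf2 : laguerreFun k z ^ 2 ≤ 4 := by
      rw [← sq_abs]; nlinarith [abs_nonneg (laguerreFun k z)]
    have h1 : z * (ν k + width k - z) ≤ 3 := by
      calc _ ≤ 1 / ν k * (3 * ν k) := by
            gcongr
            · linarith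
            · linarith [width_le k]
        _ = 3 := by field_simp
    have h2 : (laguerreFun k z ^ 2) ^ 2 ≤ 4 ^ 2 := by gcongr
    have h3 : 0 ≤ z * (ν k + width k - z) := mul_nonneg hz (by linarith)
    rw [hf4]
    calc _ ≤ (4 : ℝ) ^ 2 * 3 := by gcongr
      _ ≤ _ := by norm_num
  · have h0 : 0 < 1 / ν k := by positivity
    have hz0 : 0 < z := h0.trans_le h
    have h1 := laguerreFun_sq_le k h hz'
    have hw := weight_sq k hz0 (by linarith : z < ν k + width k)
    have hp : 0 < z * (ν k + width k - z) := mul_pos hz0 (by linarith)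
    have h2 : (laguerreFun k z ^ 2) ^ 2 ≤ (6000 * weight k z) ^ 2 := by gcongr
    rw [mul_pow, hw] at h2
    rw [hf4]
    calc _ ≤ (6000 ^ 2 * (1 / (z * (ν k + width k - z)))) * (z * (ν k + width k - z)) := by gcongr
      _ = _ := by rw [mul_assoc, one_div_mul_cancel hp.ne', mul_one]

/-! ### Beyond the turning point -/

lemma hasDerivAt_fun_mul_theta (k : ℕ) {z : ℝ} (hz : 0 < z) :
    HasDerivAt (fun z => laguerreFun k z * laguerreTheta k z)
      (laguerreTheta k z ^ 2 / z + (z - ν k) / 4 * laguerreFun k z ^ 2) z := by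
  refine ((hasDerivAt_laguerreFun k hz.ne').mul (hasDerivAt_laguerreTheta k z)).congr_deriv ?_
  ring

/-- Past the turning point `f * (z f')` is nondecreasing with limit zero. -/
lemma fun_mul_theta_nonpos (k : ℕ) {z : ℝ} (hz : ν k ≤ z) :
    laguerreFun k z * laguerreTheta k z ≤ 0 := by
  have hν := ν_pos k
  have hmono : MonotoneOn (fun z => laguerreFun k z * laguerreTheta k z) (Set.Ici (ν k)) := by
    refine monotoneOn_of_deriv_nonneg (convex_Ici _)
      ((continuous_laguerreFun k).mul (continuous_laguerreTheta k)).continuousOn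
      (fun x hx => ?_) fun x hx => ?_
    · rw [interior_Ici] at hx
      exact (hasDerivAt_fun_mul_theta k (hν.trans hx)).differentiableAt.differentiableWithinAt
    · rw [interior_Ici] at hx
      rw [(hasDerivAt_fun_mul_theta k (hν.trans hx)).deriv]
      have hx' : 0 < x := hν.trans hx
      have : 0 ≤ x - ν k := by linarith [Set.mem_Ioi.1 hx]
      positivity
  have ht : Filter.Tendsto (fun z => laguerreFun k z * laguerreTheta k z)
      Filter.atTop (nhds 0) := by
    simpa using (tendsto_laguerreFun k).mul (tendsto_laguerreTheta k)
  refine ge_of_tendsto ht ?_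
  filter_upwards [Filter.eventually_ge_atTop z] with x hx
  exact hmono hz (hz.trans hx) hx

lemma laguerreFun_sq_antitone (k : ℕ) :
    AntitoneOn (fun z => laguerreFun k z ^ 2) (Set.Ici (ν k)) := by
  have hν := ν_pos k
  refine antitoneOn_of_deriv_nonpos (convex_Ici _)
      ((continuous_laguerreFun k).pow 2).continuousOn (fun x hx => ?_) fun x hx => ?_
  · exact ((hasDerivAt_laguerreFun' k x).pow 2).differentiableAt.differentiableWithinAt
  · rw [interior_Ici] at hx
    have hx' : 0 < x := hν.trans hx
    have h1 := ((hasDerivAt_laguerreFun k hx'.ne').pow 2).deriv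
    have h2 := fun_mul_theta_nonpos k (Set.mem_Ioi.1 hx).le
    have h3 : deriv (fun z => laguerreFun k z ^ 2) x =
        2 * (laguerreFun k x * laguerreTheta k x) / x := by
      refine Eq.trans h1 ?_
      push_cast; ring
    rw [h3]
    exact div_nonpos_of_nonpos_of_nonneg (by linarith) hx'.le

/-- At the turning point the product of `f` and `z f'` is bounded uniformly in `k`. -/
lemma neg_fun_mul_theta_le (k : ℕ) :
    -(laguerreFun k (ν k) * laguerreTheta k (ν k)) ≤ 48 := by
  have hν := ν_pos k
  have hb := width_pos k
  have hE := energy_le k (z := ν k) (by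
    rw [div_le_iff₀ hν]; nlinarith [two_le_ν k]) le_rfl
  have hw := weight_sq k hν (by linarith : ν k < ν k + width k)
  have hwp := weight_pos k hν (by linarith : ν k < ν k + width k)
  have hX : ν k + width k - ν k = width k := by ring
  have hy : ratio k (ν k) = ν k / width k := by rw [ratio, hX]
  rw [hX] at hw
  have hy2 : 1 / 2 ≤ ratio k (ν k) := by
    rw [hy, div_le_div_iff₀ (by norm_num) hb]; linarith [width_le k]
  have hwy : (weight k (ν k) * ratio k (ν k)) ^ 2 = 1 / 27 := by
    rw [mul_pow, hw, hy]
    have := width_cube k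
    field_simp
    linarith
  have hwy' : 1 / 6 ≤ weight k (ν k) * ratio k (ν k) := by
    have : 0 < weight k (ν k) * ratio k (ν k) := by positivity
    nlinarith
  have hB : ratio k (ν k) * (-(laguerreFun k (ν k) * laguerreTheta k (ν k))) ≤
      2 * ((ν k * (ν k - ν k) / 4 + (3 * ratio k (ν k) ^ 2 + 1) / 8) * laguerreFun k (ν k) ^ 2 +
    (1 - ratio k (ν k)) / 2 * (laguerreFun k (ν k) * laguerreTheta k (ν k)) +
      laguerreTheta k (ν k) ^ 2) := by
    have h2 := fun_mul_theta_nonpos k le_rfl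
    generalize laguerreFun k (ν k) = f at *
    generalize laguerreTheta k (ν k) = g at *
    generalize ratio k (ν k) = y at *
    have h7 : 0 ≤ (y - 1 / 2) * -(f * g) := mul_nonneg (by linarith) (by linarith)
    nlinarith [sq_nonneg (y * f + 2 * g), sq_nonneg (y * f), sq_nonneg f]
  have h3 : weight k (ν k) * (ratio k (ν k) * (-(laguerreFun k (ν k) * laguerreTheta k (ν k))))
      ≤ 8 := by
    refine (mul_le_mul_of_nonneg_left hB hwp.le).trans ?_
    unfold energy at hE
    linarith
  have h2 := fun_mul_theta_nonpos k le_rfl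
  nlinarith

lemma laguerreFun_sq_mul_le (k : ℕ) {z : ℝ} (hz : ν k ≤ z) :
    laguerreFun k z ^ 2 * (z - ν k) ^ 2 ≤ 400 := by
  have hν := ν_pos k
  -- `h` is nondecreasing on `[ν, z]` since `f ^ 2` is nonincreasing there
  set h : ℝ → ℝ := fun x => laguerreFun k x * laguerreTheta k x -
    (x - ν k) ^ 2 / 8 * laguerreFun k z ^ 2 with hh
  have hder : ∀ x, 0 < x → HasDerivAt h ((laguerreTheta k x ^ 2 / x +
      (x - ν k) / 4 * laguerreFun k x ^ 2) - (x - ν k) / 4 * laguerreFun k z ^ 2) x := by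
    intro x hx
    have h1 : HasDerivAt (fun x => (x - ν k) ^ 2 / 8 * laguerreFun k z ^ 2)
        ((x - ν k) / 4 * laguerreFun k z ^ 2) x := by
      have := ((((hasDerivAt_id x).sub_const (ν k)).pow 2).div_const 8).mul_const
        (laguerreFun k z ^ 2)
      refine this.congr_deriv ?_
      simp only [id]; push_cast; ring
    exact (hasDerivAt_fun_mul_theta k hx).sub h1
  have hmono : MonotoneOn h (Set.Icc (ν k) z) := by
    refine monotoneOn_of_deriv_nonneg (convex_Icc _ _)
      (fun x hx => (hder x (hν.trans_le hx.1)).continuousAt.continuousWithinAt)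
      (fun x hx => ?_) fun x hx => ?_
    · have hx := interior_subset hx
      exact (hder x (hν.trans_le hx.1)).differentiableAt.differentiableWithinAt
    · have hx := interior_subset hx
      have hx0 : 0 < x := hν.trans_le hx.1
      rw [(hder x hx0).deriv]
      have h1 : laguerreFun k z ^ 2 ≤ laguerreFun k x ^ 2 :=
        laguerreFun_sq_antitone k (Set.mem_Ici.2 hx.1) (Set.mem_Ici.2 hz) hx.2
      have h2 : (x - ν k) / 4 * laguerreFun k z ^ 2 ≤ (x - ν k) / 4 * laguerreFun k x ^ 2 := by
        have : 0 ≤ x - ν k := by linarith [hx.1]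
        gcongr
      have : 0 ≤ laguerreTheta k x ^ 2 / x := by positivity
      linarith
  have h1 := hmono ⟨le_rfl, hz⟩ ⟨hz, le_rfl⟩ hz
  simp only [hh, sub_self] at h1
  have h2 := fun_mul_theta_nonpos k hz
  have h3 := neg_fun_mul_theta_le k
  nlinarith

lemma laguerreFun_turning (k : ℕ) : |laguerreFun k (ν k)| * ν k ^ (1 / 3 : ℝ) ≤ 100 := by
  have hν := ν_pos k
  have h := laguerreFun_pow_four_le k hν.le le_rfl
  have hb : ν k * (ν k + width k - ν k) = 3 * (ν k ^ (1 / 3 : ℝ)) ^ 4 := by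
    have h3 : (ν k ^ (1 / 3 : ℝ)) ^ 3 = ν k := by
      rw [← Real.rpow_natCast, ← Real.rpow_mul hν.le]; norm_num
    have : ν k * (ν k + width k - ν k) = ν k * width k := by ring
    rw [this, width]
    nth_rewrite 1 [← h3]
    ring
  rw [hb] at h
  have hp : 0 < ν k ^ (1 / 3 : ℝ) := Real.rpow_pos_of_pos hν _
  have h4 : (|laguerreFun k (ν k)| * ν k ^ (1 / 3 : ℝ)) ^ 4 ≤ 100 ^ 4 := by
    rw [mul_pow, ← abs_pow, abs_of_nonneg (by positivity)]
    nlinarith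
  exact le_of_pow_le_pow_left₀ (by norm_num) (by norm_num) h4

lemma abs_laguerreFun_le (k : ℕ) {z : ℝ} (hz : 0 ≤ z) : |laguerreFun k z| ≤ 100 := by
  have hν := two_le_ν k
  have key : ∀ z, 0 ≤ z → z ≤ ν k → |laguerreFun k z| ≤ 100 := by
    intro z hz hz'
    rcases le_total z (1 / ν k) with h | h
    · exact (abs_laguerreFun_le_near_zero k hz h).trans (by norm_num)
    · have h1 := laguerreFun_pow_four_le k hz hz'
      have hp : 1 ≤ z * (ν k + width k - z) := by
        have hb := three_le_width k
        rw [div_le_iff₀ (ν_pos k)] at h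
        rcases le_total z 1 with h2 | h2 <;> nlinarith
      have h4 : |laguerreFun k z| ^ 4 ≤ 100 ^ 4 := by
        rw [← abs_pow, abs_of_nonneg (by positivity)]
        have : 0 ≤ laguerreFun k z ^ 4 := by positivity
        nlinarith
      exact le_of_pow_le_pow_left₀ (by norm_num) (by norm_num) h4
  rcases le_total z (ν k) with h | h
  · exact key z hz h
  · have h1 : laguerreFun k z ^ 2 ≤ laguerreFun k (ν k) ^ 2 :=
      laguerreFun_sq_antitone k (Set.mem_Ici.2 le_rfl) (Set.mem_Ici.2 h) h
    exact (sq_le_sq.1 h1).trans (key _ (ν_pos k).le le_rfl)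

lemma laguerreFun_pow_four_le_left (k : ℕ) {z : ℝ} (hz : 0 ≤ z) (hz' : z ≤ ν k / 2) :
    laguerreFun k z ^ 4 * (ν k * (z + 1 / ν k)) ≤ 120 ^ 4 := by
  have hν := ν_pos k
  have h1 := laguerreFun_pow_four_le k hz (by linarith)
  have h2 : laguerreFun k z ^ 4 ≤ 100 ^ 4 := by
    rw [← Even.pow_abs (by decide)]
    exact pow_le_pow_left₀ (abs_nonneg _) (abs_laguerreFun_le k hz) 4
  have h3 : ν k * (z + 1 / ν k) = ν k * z + 1 := by field_simp
  have h4 : ν k * z ≤ 2 * (z * (ν k + width k - z)) := by nlinarith [width_pos k]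
  have h5 : laguerreFun k z ^ 4 * (ν k * z) ≤
    laguerreFun k z ^ 4 * (2 * (z * (ν k + width k - z))) := by gcongr
  rw [h3]
  linarith

lemma laguerreFun_pow_four_le_right (k : ℕ) {z : ℝ} (hz : ν k / 2 ≤ z) (hz' : z ≤ ν k) :
    laguerreFun k z ^ 4 * (ν k * (ν k - z + 1 / ν k)) ≤ 120 ^ 4 := by
  have hν := ν_pos k
  have h1 := laguerreFun_pow_four_le k (by linarith) hz'
  have h2 : laguerreFun k z ^ 4 ≤ 100 ^ 4 := by
    rw [← Even.pow_abs (by decide)]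
    exact pow_le_pow_left₀ (abs_nonneg _) (abs_laguerreFun_le k (by linarith)) 4
  have h3 : ν k * (ν k - z + 1 / ν k) = ν k * (ν k - z) + 1 := by field_simp
  have h4 : ν k * (ν k - z) ≤ 2 * (z * (ν k + width k - z)) := by
    nlinarith [width_pos k, mul_nonneg (sub_nonneg.2 hz) (sub_nonneg.2 hz')]
  have h5 : laguerreFun k z ^ 4 * (ν k * (ν k - z)) ≤
    laguerreFun k z ^ 4 * (2 * (z * (ν k + width k - z))) := by gcongr
  rw [h3]
  linarith

lemma abs_laguerreFun_le_tail (k : ℕ) {z : ℝ} (hz : ν k ≤ z) :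
    |laguerreFun k z| * (ν k ^ (1 / 3 : ℝ) + (z - ν k)) ≤ 120 := by
  have h1 : laguerreFun k z ^ 2 ≤ laguerreFun k (ν k) ^ 2 :=
      laguerreFun_sq_antitone k (Set.mem_Ici.2 le_rfl) (Set.mem_Ici.2 hz) hz
  have h2 := laguerreFun_turning k
  have hp : 0 < ν k ^ (1 / 3 : ℝ) := Real.rpow_pos_of_pos (ν_pos k) _
  have h3 : |laguerreFun k z| * ν k ^ (1 / 3 : ℝ) ≤ 100 :=
    (mul_le_mul_of_nonneg_right (sq_le_sq.1 h1) hp.le).trans h2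
  have h4 : |laguerreFun k z| * (z - ν k) ≤ 20 := by
    have h5 := laguerreFun_sq_mul_le k hz
    have h6 : 0 ≤ z - ν k := by linarith
    refine le_of_pow_le_pow_left₀ (n := 2) (by norm_num) (by norm_num) ?_
    rw [mul_pow, sq_abs]
    linarith
  linarith

/-! ### Norms on the half-line -/

lemma lintegral_Ioc_ofReal {g : ℝ → ℝ} {a b : ℝ} (hab : a ≤ b) (hg : ContinuousOn g (Icc a b))
    (h0 : ∀ x ∈ Icc a b, 0 ≤ g x) :
    ∫⁻ x in Ioc a b, ENNReal.ofReal (g x) = ENNReal.ofReal (∫ x in a..b, g x) := by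
  rw [intervalIntegral.integral_of_le hab, ofReal_integral_eq_lintegral_ofReal]
  · exact (hg.integrableOn_Icc).mono_set Ioc_subset_Icc_self
  · filter_upwards [ae_restrict_mem measurableSet_Ioc] with x hx
    exact h0 x (Ioc_subset_Icc_self hx)

/-- Rewrites a bound on `f ^ 4` as a bound on `|f| ^ q`. -/
lemma abs_rpow_le_of_pow_four {x M n w q : ℝ} (hM : 0 ≤ M) (hn : 0 < n) (hw : 0 < w) (hq : 0 ≤ q)
    (h : x ^ 4 * (n * w) ≤ M ^ 4) :
    |x| ^ q ≤ M ^ q * n ^ (-(q / 4)) * w ^ (-(q / 4)) := by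
  have h1 : |x| ^ 4 ≤ M ^ 4 * (n * w)⁻¹ := by
    rw [← div_eq_mul_inv, le_div_iff₀ (by positivity), Even.pow_abs (by decide)]
    exact h
  have h2 : ∀ y : ℝ, 0 ≤ y → (y ^ 4) ^ (q / 4) = y ^ q := by
    intro y hy
    rw [← Real.rpow_natCast, ← Real.rpow_mul hy]; congr 1; push_cast; ring
  rw [← h2 _ (abs_nonneg x), ← h2 _ hM, Real.rpow_neg hn.le, Real.rpow_neg hw.le,
    ← Real.inv_rpow hn.le, ← Real.inv_rpow hw.le,
    ← Real.mul_rpow (by positivity) (by positivity),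
    ← Real.mul_rpow (by positivity) (by positivity), mul_assoc, ← mul_inv]
  exact Real.rpow_le_rpow (by positivity) h1 (by positivity)

lemma integral_rpow_mono_right {a b c s : ℝ} (ha : 0 < a) (hab : a ≤ b) (hbc : b ≤ c) :
    ∫ x in a..b, x ^ s ≤ ∫ x in a..c, x ^ s := by
  have hi : ∀ {u v : ℝ}, a ≤ u → u ≤ v → IntervalIntegrable (fun x : ℝ => x ^ s) volume u v := by
    intro u v hu huv
    refine intervalIntegral.intervalIntegrable_rpow (Or.inr ?_)
    rw [uIcc_of_le huv]
    exact fun h => absurd h.1 (by linarith)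
  rw [← intervalIntegral.integral_add_adjacent_intervals (hi le_rfl hab) (hi hab hbc)]
  have : 0 ≤ ∫ x in b..c, x ^ s := by
    refine intervalIntegral.integral_nonneg hbc fun x hx => ?_
    exact Real.rpow_nonneg (by linarith [hx.1]) _
  linarith

lemma lintegral_left_le (k : ℕ) {q : ℝ} (hq : 0 ≤ q) :
    ∫⁻ z in Ioc 0 (ν k / 2), ENNReal.ofReal (|laguerreFun k z| ^ q) ≤
      ENNReal.ofReal (120 ^ q * ν k ^ (-(q / 4)) *
        ∫ x in (1 / ν k)..(2 * ν k), x ^ (-(q / 4))) := by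
  have hν := two_le_ν k
  have hν0 := ν_pos k
  have h1ν : 0 < 1 / ν k := by positivity
  have h1ν' : 1 / ν k ≤ ν k := by rw [div_le_iff₀ hν0]; nlinarith
  calc _ ≤ ∫⁻ z in Ioc 0 (ν k / 2), ENNReal.ofReal
        (120 ^ q * ν k ^ (-(q / 4)) * (z + 1 / ν k) ^ (-(q / 4))) := by
        refine setLIntegral_mono' measurableSet_Ioc fun z hz => ENNReal.ofReal_le_ofReal ?_
        exact abs_rpow_le_of_pow_four (by norm_num) hν0 (by linarith [hz.1]) hq
          (laguerreFun_pow_four_le_left k hz.1.le hz.2)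
    _ = ENNReal.ofReal (∫ z in (0 : ℝ)..(ν k / 2),
        120 ^ q * ν k ^ (-(q / 4)) * (z + 1 / ν k) ^ (-(q / 4))) := by
        refine lintegral_Ioc_ofReal (by positivity) ?_ fun z hz => ?_
        · refine ContinuousOn.mul continuousOn_const (ContinuousOn.rpow_const (by fun_prop) ?_)
          intro z hz
          left; linarith [hz.1]
        · have : 0 < z + 1 / ν k := by linarith [hz.1]
          positivity
    _ ≤ _ := by
        refine ENNReal.ofReal_le_ofReal ?_
        rw [intervalIntegral.integral_const_mul,
          intervalIntegral.integral_comp_add_right (fun x => x ^ (-(q / 4))), zero_add]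
        refine mul_le_mul_of_nonneg_left ?_ (by positivity)
        exact integral_rpow_mono_right h1ν (by linarith) (by linarith)

lemma lintegral_right_le (k : ℕ) {q : ℝ} (hq : 0 ≤ q) :
    ∫⁻ z in Ioc (ν k / 2) (ν k), ENNReal.ofReal (|laguerreFun k z| ^ q) ≤
      ENNReal.ofReal (120 ^ q * ν k ^ (-(q / 4)) *
        ∫ x in (1 / ν k)..(2 * ν k), x ^ (-(q / 4))) := by
  have hν := two_le_ν k
  have hν0 := ν_pos k
  have h1ν : 0 < 1 / ν k := by positivity
  have h1ν' : 1 / ν k ≤ ν k := by rw [div_le_iff₀ hν0]; nlinarith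
  calc _ ≤ ∫⁻ z in Ioc (ν k / 2) (ν k), ENNReal.ofReal
        (120 ^ q * ν k ^ (-(q / 4)) * (ν k + 1 / ν k - z) ^ (-(q / 4))) := by
        refine setLIntegral_mono' measurableSet_Ioc fun z hz => ENNReal.ofReal_le_ofReal ?_
        refine abs_rpow_le_of_pow_four (by norm_num) hν0 (by linarith [hz.2]) hq ?_
        have := laguerreFun_pow_four_le_right k hz.1.le hz.2
        rwa [show ν k - z + 1 / ν k = ν k + 1 / ν k - z by ring] at this
    _ = ENNReal.ofReal (∫ z in (ν k / 2)..(ν k),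
        120 ^ q * ν k ^ (-(q / 4)) * (ν k + 1 / ν k - z) ^ (-(q / 4))) := by
        refine lintegral_Ioc_ofReal (by linarith) ?_ fun z hz => ?_
        · refine ContinuousOn.mul continuousOn_const (ContinuousOn.rpow_const (by fun_prop) ?_)
          intro z hz
          left; linarith [hz.2]
        · have : 0 < ν k + 1 / ν k - z := by linarith [hz.2]
          positivity
    _ ≤ _ := by
        refine ENNReal.ofReal_le_ofReal ?_
        rw [intervalIntegral.integral_const_mul,
          intervalIntegral.integral_comp_sub_left (fun x => x ^ (-(q / 4)))]
        refine mul_le_mul_of_nonneg_left ?_ (by positivity)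
        rw [show ν k + 1 / ν k - ν k = 1 / ν k by ring]
        exact integral_rpow_mono_right h1ν (by linarith) (by linarith)

lemma lintegral_tail_le (k : ℕ) {q : ℝ} (hq : 2 ≤ q) :
    ∫⁻ z in Ioi (ν k), ENNReal.ofReal (|laguerreFun k z| ^ q) ≤
      ENNReal.ofReal (120 ^ q * ν k ^ ((1 - q) / 3)) := by
  have hν0 := ν_pos k
  set h := ν k ^ (1 / 3 : ℝ) with hh
  have hp : 0 < h := Real.rpow_pos_of_pos hν0 _
  have hint : IntegrableOn (fun z : ℝ => (z + (h - ν k)) ^ (-q)) (Ioi (ν k)) := 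
    integrableOn_add_rpow_Ioi_of_lt (by linarith) (by linarith)
  calc _ ≤ ∫⁻ z in Ioi (ν k), ENNReal.ofReal (120 ^ q * (z + (h - ν k)) ^ (-q)) := by
        refine setLIntegral_mono' measurableSet_Ioi fun z hz => ENNReal.ofReal_le_ofReal ?_
        have hz' : ν k < z := hz
        have h1 := abs_laguerreFun_le_tail k hz'.le
        have hw : 0 < z + (h - ν k) := by linarith
        rw [Real.rpow_neg hw.le, ← Real.inv_rpow hw.le, ← Real.mul_rpow (by norm_num)
          (by positivity)]
        refine Real.rpow_le_rpow (abs_nonneg _) ?_ (by linarith)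
        rw [← div_eq_mul_inv, le_div_iff₀ hw]
        calc _ = |laguerreFun k z| * (ν k ^ (1 / 3 : ℝ) + (z - ν k)) := by rw [← hh]; ring
          _ ≤ _ := h1
    _ = ENNReal.ofReal (∫ z in Ioi (ν k), 120 ^ q * (z + (h - ν k)) ^ (-q)) := by
        rw [ofReal_integral_eq_lintegral_ofReal (hint.const_mul _)]
        filter_upwards [ae_restrict_mem measurableSet_Ioi] with x hx
        have hx' : ν k < x := hx
        have : 0 < x + (h - ν k) := by linarith
        positivity
    _ ≤ _ := by
        refine ENNReal.ofReal_le_ofReal ?_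
        rw [integral_const_mul]
        refine mul_le_mul_of_nonneg_left ?_ (by positivity)
        have h2 := (measurePreserving_add_right volume (h - ν k)).setIntegral_preimage_emb
          (measurableEmbedding_addRight _) (fun z : ℝ => z ^ (-q)) (Ioi h)
        rw [preimage_add_const_Ioi, sub_sub_cancel] at h2
        rw [h2, integral_Ioi_rpow_of_lt (by linarith) hp, hh,
          ← Real.rpow_mul hν0.le, show 1 / 3 * (-q + 1) = (1 - q) / 3 by ring,
          neg_div, ← div_neg]
        refine div_le_self (by positivity) (by linarith)

lemma lintegral_abs_rpow_le (k : ℕ) {q : ℝ} (hq : 2 ≤ q) :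
    ∫⁻ z in Ioi 0, ENNReal.ofReal (|laguerreFun k z| ^ q) ≤
      ENNReal.ofReal (120 ^ q * (2 * (ν k ^ (-(q / 4)) *
        ∫ x in (1 / ν k)..(2 * ν k), x ^ (-(q / 4))) + ν k ^ ((1 - q) / 3))) := by
  have hν := two_le_ν k
  have hν0 := ν_pos k
  have hsub : Ioi (0 : ℝ) ⊆ Ioc 0 (ν k / 2) ∪ (Ioc (ν k / 2) (ν k) ∪ Ioi (ν k)) := by
    intro z hz
    simp only [mem_union, mem_Ioc, mem_Ioi] at hz ⊢
    rcases le_or_gt z (ν k / 2) with h | h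
    · exact Or.inl ⟨hz, h⟩
    · rcases le_or_gt z (ν k) with h' | h'
      · exact Or.inr (Or.inl ⟨h, h'⟩)
      · exact Or.inr (Or.inr h')
  have hI : 0 ≤ ∫ x in (1 / ν k)..(2 * ν k), x ^ (-(q / 4)) := by
    have h1ν' : 1 / ν k ≤ 2 * ν k := by rw [div_le_iff₀ hν0]; nlinarith
    refine intervalIntegral.integral_nonneg h1ν' fun x hx => Real.rpow_nonneg ?_ _
    have : 0 < 1 / ν k := by positivity
    linarith [hx.1]
  refine (lintegral_mono_set hsub).trans ((lintegral_union_le _ _ _).trans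
    ((add_le_add (lintegral_left_le k (by linarith)) ((lintegral_union_le _ _ _).trans
      (add_le_add (lintegral_right_le k (by linarith)) (lintegral_tail_le k hq)))).trans ?_))
  rw [← ENNReal.ofReal_add (by positivity) (by positivity),
    ← ENNReal.ofReal_add (by positivity) (by positivity)]
  refine ENNReal.ofReal_le_ofReal (le_of_eq ?_)
  ring

lemma lintegral_le_of_lt_four {q : ℝ} (hq : 2 ≤ q) (hq4 : q < 4) :
    ∃ C : ℝ, 0 < C ∧ ∀ k, ∫⁻ z in Ioi 0, ENNReal.ofReal (|laguerreFun k z| ^ q) ≤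
      ENNReal.ofReal (C * ν k ^ (1 - q / 2)) := by
  have hs : 0 < 1 - q / 4 := by linarith
  refine ⟨120 ^ q * (2 * (2 ^ (1 - q / 4) / (1 - q / 4)) + 1), by positivity, fun k => ?_⟩
  have hν := two_le_ν k
  have hν0 := ν_pos k
  refine (lintegral_abs_rpow_le k hq).trans (ENNReal.ofReal_le_ofReal ?_)
  rw [mul_assoc]
  refine mul_le_mul_of_nonneg_left ?_ (by positivity)
  have h1 : ∫ x in (1 / ν k)..(2 * ν k), x ^ (-(q / 4)) ≤
      2 ^ (1 - q / 4) / (1 - q / 4) * ν k ^ (1 - q / 4) := by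
    rw [integral_rpow (Or.inl (by linarith)), show -(q / 4) + 1 = 1 - q / 4 by ring,
      Real.mul_rpow (by norm_num) hν0.le, div_mul_eq_mul_div]
    gcongr
    have : 0 ≤ (1 / ν k) ^ (1 - q / 4) := by positivity
    linarith
  have h2 : ν k ^ ((1 - q) / 3) ≤ ν k ^ (1 - q / 2) :=
    Real.rpow_le_rpow_of_exponent_le (by linarith) (by linarith)
  have h3 : ν k ^ (-(q / 4)) * ν k ^ (1 - q / 4) = ν k ^ (1 - q / 2) := by
    rw [← Real.rpow_add hν0]; congr 1; ring
  have h4 : ν k ^ (-(q / 4)) * ∫ x in (1 / ν k)..(2 * ν k), x ^ (-(q / 4)) ≤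
      2 ^ (1 - q / 4) / (1 - q / 4) * ν k ^ (1 - q / 2) := by
    calc _ ≤ ν k ^ (-(q / 4)) * (2 ^ (1 - q / 4) / (1 - q / 4) * ν k ^ (1 - q / 4)) := by gcongr
      _ = _ := by rw [← h3]; ring
  linarith

lemma lintegral_le_of_four_lt {q : ℝ} (hq4 : 4 < q) :
    ∃ C : ℝ, 0 < C ∧ ∀ k, ∫⁻ z in Ioi 0, ENNReal.ofReal (|laguerreFun k z| ^ q) ≤
      ENNReal.ofReal (C * (ν k)⁻¹) := by
  have hs : 0 < q / 4 - 1 := by linarith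
  refine ⟨120 ^ q * (2 * (1 / (q / 4 - 1)) + 1), by positivity, fun k => ?_⟩
  have hν := two_le_ν k
  have hν0 := ν_pos k
  refine (lintegral_abs_rpow_le k (by linarith)).trans (ENNReal.ofReal_le_ofReal ?_)
  rw [mul_assoc]
  refine mul_le_mul_of_nonneg_left ?_ (by positivity)
  have h1ν : 0 < 1 / ν k := by positivity
  have h1ν' : 1 / ν k ≤ 2 * ν k := by rw [div_le_iff₀ hν0]; nlinarith
  have h1 : ∫ x in (1 / ν k)..(2 * ν k), x ^ (-(q / 4)) ≤
      1 / (q / 4 - 1) * ν k ^ (q / 4 - 1) := by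
    rw [integral_rpow (Or.inr ⟨by intro h; linarith, by
        rw [uIcc_of_le h1ν']; exact fun h => absurd h.1 (by linarith)⟩),
      show -(q / 4) + 1 = -(q / 4 - 1) by ring, Real.rpow_neg h1ν.le (q / 4 - 1),
      Real.div_rpow zero_le_one hν0.le, Real.one_rpow, one_div_mul_eq_div, one_div, inv_inv,
      div_neg, ← neg_div, neg_sub]
    gcongr
    have : 0 ≤ (2 * ν k) ^ (-(q / 4 - 1)) := by positivity
    linarith
  have h2 : ν k ^ ((1 - q) / 3) ≤ (ν k)⁻¹ := by
    rw [← Real.rpow_neg_one]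
    exact Real.rpow_le_rpow_of_exponent_le (by linarith) (by linarith)
  have h3 : ν k ^ (-(q / 4)) * ν k ^ (q / 4 - 1) = (ν k)⁻¹ := by
    rw [← Real.rpow_add hν0, ← Real.rpow_neg_one]; congr 1; ring
  have h4 : ν k ^ (-(q / 4)) * ∫ x in (1 / ν k)..(2 * ν k), x ^ (-(q / 4)) ≤
      1 / (q / 4 - 1) * (ν k)⁻¹ := by
    calc _ ≤ ν k ^ (-(q / 4)) * (1 / (q / 4 - 1) * ν k ^ (q / 4 - 1)) := by gcongr
      _ = _ := by rw [← h3]; ring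
  linarith

lemma log_two_le_log_ν (k : ℕ) : Real.log 2 ≤ Real.log (ν k) :=
  Real.log_le_log (by norm_num) (two_le_ν k)

lemma log_ν_pos (k : ℕ) : 0 < Real.log (ν k) :=
  (Real.log_pos (by norm_num)).trans_le (log_two_le_log_ν k)

lemma lintegral_four_le :
    ∃ C : ℝ, 0 < C ∧ ∀ k, ∫⁻ z in Ioi 0, ENNReal.ofReal (|laguerreFun k z| ^ (4 : ℝ)) ≤
      ENNReal.ofReal (C * ((ν k)⁻¹ * Real.log (ν k))) := by
  refine ⟨120 ^ (4 : ℝ) * 8, by positivity, fun k => ?_⟩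
  have hν := two_le_ν k
  have hν0 := ν_pos k
  refine (lintegral_abs_rpow_le k (by norm_num)).trans (ENNReal.ofReal_le_ofReal ?_)
  rw [mul_assoc]
  refine mul_le_mul_of_nonneg_left ?_ (by positivity)
  have h1ν : 0 < 1 / ν k := by positivity
  have hlog := log_two_le_log_ν k
  rw [show -((4 : ℝ) / 4) = -1 by norm_num, show (1 - (4 : ℝ)) / 3 = -1 by norm_num]
  simp_rw [Real.rpow_neg_one]
  rw [integral_inv_of_pos h1ν (by positivity),
    show 2 * ν k / (1 / ν k) = 2 * (ν k * ν k) by field_simp,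
    Real.log_mul (by norm_num) (by positivity), Real.log_mul hν0.ne' hν0.ne']
  have h5 : 1 / 2 ≤ Real.log 2 := by linarith [Real.log_two_gt_d9]
  have h6 : 0 < (ν k)⁻¹ := by positivity
  have h7 : 2 * (Real.log 2 + (Real.log (ν k) + Real.log (ν k))) + 1 ≤ 8 * Real.log (ν k) := by
    linarith
  calc _ = (ν k)⁻¹ * (2 * (Real.log 2 + (Real.log (ν k) + Real.log (ν k))) + 1) := by ring
    _ ≤ (ν k)⁻¹ * (8 * Real.log (ν k)) := by gcongr
    _ = _ := by ring

/-! ### Transfer to the plane -/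

/-- The map `x ↦ ‖x‖ ^ 2` sends the area of the plane to `π` times Lebesgue measure on `(0, ∞)`. -/
lemma map_norm_sq_volume :
    Measure.map (fun x : EuclideanSpace ℝ (Fin 2) => ‖x‖ ^ 2) volume =
      ENNReal.ofReal Real.pi • volume.restrict (Ioi (0 : ℝ)) := by
  have hmeas : Measurable (fun x : EuclideanSpace ℝ (Fin 2) => ‖x‖ ^ 2) := by fun_prop
  have hball : ∀ r : ℝ, volume (Metric.ball (0 : EuclideanSpace ℝ (Fin 2)) √r) =
      ENNReal.ofReal (Real.pi * max r 0) := by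
    intro r
    rw [EuclideanSpace.volume_ball_fin_two, ← ENNReal.ofReal_pow (Real.sqrt_nonneg r)]
    rw [← ENNReal.ofReal_mul (by positivity), mul_comm]
    congr 2
    rcases le_total 0 r with h | h
    · rw [Real.sq_sqrt h, max_eq_left h]
    · rw [Real.sqrt_eq_zero_of_nonpos h, max_eq_right h]; simp
  have hval : ∀ a b : ℝ, a < b →
      Measure.map (fun x : EuclideanSpace ℝ (Fin 2) => ‖x‖ ^ 2) volume (Ico a b) =
        ENNReal.ofReal (Real.pi * max b 0 - Real.pi * max a 0) := by
    intro a b hab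
    rw [Measure.map_apply hmeas measurableSet_Ico]
    have : (fun x : EuclideanSpace ℝ (Fin 2) => ‖x‖ ^ 2) ⁻¹' Ico a b =
        Metric.ball 0 √b \ Metric.ball 0 √a := by
      ext x
      simp only [mem_preimage, mem_Ico, mem_sdiff, Metric.mem_ball, dist_zero_right,
        Real.lt_sqrt (norm_nonneg x), not_lt, and_comm]
    rw [this, measure_sdiff (Metric.ball_subset_ball (Real.sqrt_le_sqrt hab.le))
      measurableSet_ball.nullMeasurableSet (by rw [hball]; exact ENNReal.ofReal_ne_top),
      hball, hball, ENNReal.ofReal_sub _ (by positivity)]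
  refine Measure.ext_of_Ico' _ _ (fun a b hab => ?_) fun a b hab => ?_
  · rw [hval a b hab]; exact ENNReal.ofReal_ne_top
  · rw [hval a b hab, Measure.smul_apply, Measure.restrict_apply measurableSet_Ico, smul_eq_mul,
      ← mul_sub, ENNReal.ofReal_mul Real.pi_pos.le]
    congr 1
    rcases le_or_gt a 0 with ha | ha
    · have : Ico a b ∩ Ioi 0 = Ioo 0 b := by
        ext x
        simp only [mem_inter_iff, mem_Ico, mem_Ioi, mem_Ioo]
        constructor
        · rintro ⟨⟨-, h⟩, h'⟩; exact ⟨h', h⟩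
        · rintro ⟨h, h'⟩; exact ⟨⟨ha.trans h.le, h'⟩, h⟩
      rw [this, Real.volume_Ioo, max_eq_right ha]
      rcases le_total b 0 with hb | hb
      · rw [max_eq_right hb, sub_zero, ENNReal.ofReal_of_nonpos (by linarith : b - 0 ≤ 0)]; simp
      · rw [max_eq_left hb]
    · have : Ico a b ∩ Ioi 0 = Ico a b :=
        inter_eq_left.2 fun x hx => ha.trans_le hx.1
      rw [this, Real.volume_Ico, max_eq_left ha.le, max_eq_left (ha.trans hab).le]

lemma measurable_norm_sq : Measurable (fun x : EuclideanSpace ℝ (Fin 2) => ‖x‖ ^ 2) := by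
  fun_prop

lemma lintegral_norm_sq (g : ℝ → ENNReal) (hg : Measurable g) :
    ∫⁻ x : EuclideanSpace ℝ (Fin 2), g (‖x‖ ^ 2) =
      ENNReal.ofReal Real.pi * ∫⁻ z in Ioi 0, g z := by
  rw [← lintegral_map hg measurable_norm_sq, map_norm_sq_volume, lintegral_smul_measure,
    smul_eq_mul]

lemma integral_norm_sq (g : ℝ → ℝ) (hg : Continuous g) :
    ∫ x : EuclideanSpace ℝ (Fin 2), g (‖x‖ ^ 2) = Real.pi * ∫ z in Ioi 0, g z := by
  rw [← integral_map measurable_norm_sq.aemeasurable hg.aestronglyMeasurable, map_norm_sq_volume,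
    integral_smul_measure, ENNReal.toReal_ofReal Real.pi_pos.le, smul_eq_mul]

lemma integrable_norm_sq {g : ℝ → ℝ} (hg : Continuous g) (h : IntegrableOn g (Ioi 0)) :
    Integrable (fun x : EuclideanSpace ℝ (Fin 2) => g (‖x‖ ^ 2)) := by
  have : Integrable g (Measure.map (fun x : EuclideanSpace ℝ (Fin 2) => ‖x‖ ^ 2) volume) := by
    rw [map_norm_sq_volume]
    exact h.smul_measure ENNReal.ofReal_ne_top
  exact (integrable_map_measure hg.aestronglyMeasurable measurable_norm_sq.aemeasurable).1 this

lemma abs_e_le (k : ℕ) (x : EuclideanSpace ℝ (Fin 2)) :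
    |e k x| ≤ |laguerreFun k (‖x‖ ^ 2)| := by
  have h : 1 ≤ √Real.pi := Real.one_le_sqrt.2 (by linarith [Real.pi_gt_three])
  rw [e, abs_mul, abs_of_nonneg (by positivity)]
  refine mul_le_of_le_one_left (abs_nonneg _) ?_
  rw [div_le_one (by linarith)]
  exact h

/-- Transfer of an `L^q` bound for the Laguerre function on the half-line to the plane. -/
lemma eLpNorm_e_le {q : ℝ} (hq : 0 < q) (k : ℕ) {B : ℝ} (hB : 0 ≤ B)
    (h : ∫⁻ z in Ioi 0, ENNReal.ofReal (|laguerreFun k z| ^ q) ≤ ENNReal.ofReal B) :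
    eLpNorm (e k) (ENNReal.ofReal q) volume ≤ ENNReal.ofReal ((Real.pi * B) ^ (1 / q)) := by
  rw [eLpNorm_eq_lintegral_rpow_enorm_toReal (by simpa using hq) ENNReal.ofReal_ne_top,
    ENNReal.toReal_ofReal hq.le, ← ENNReal.ofReal_rpow_of_nonneg (by positivity) (by positivity)]
  refine ENNReal.rpow_le_rpow ?_ (by positivity)
  have hm : Measurable fun z => ENNReal.ofReal (|laguerreFun k z| ^ q) :=
    ((continuous_laguerreFun k).abs.measurable.pow_const q).ennreal_ofReal
  calc ∫⁻ x, ‖e k x‖ₑ ^ q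
      ≤ ∫⁻ x : EuclideanSpace ℝ (Fin 2), ENNReal.ofReal (|laguerreFun k (‖x‖ ^ 2)| ^ q) := by
        refine lintegral_mono fun x => ?_
        rw [Real.enorm_eq_ofReal_abs, ENNReal.ofReal_rpow_of_nonneg (abs_nonneg _) hq.le]
        exact ENNReal.ofReal_le_ofReal
          (Real.rpow_le_rpow (abs_nonneg _) (abs_e_le k x) hq.le)
    _ = ENNReal.ofReal Real.pi * ∫⁻ z in Ioi 0, ENNReal.ofReal (|laguerreFun k z| ^ q) :=
        lintegral_norm_sq _ hm
    _ ≤ _ := by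
        rw [ENNReal.ofReal_mul Real.pi_pos.le]
        gcongr

lemma eLpNorm_e_top_le (k : ℕ) : eLpNorm (e k) ⊤ volume ≤ ENNReal.ofReal 100 := by
  rw [eLpNorm_exponent_top]
  refine eLpNormEssSup_le_of_ae_bound (Filter.Eventually.of_forall fun x => ?_)
  exact (abs_e_le k x).trans (abs_laguerreFun_le k (by positivity))

theorem eLpNorm_e_le_of_ne_four (q : ENNReal) (hq : 2 ≤ q) (hq4 : q ≠ 4) :
    ∃ C : ℝ, 0 < C ∧ ∀ k : ℕ, eLpNorm (e k) q volume ≤ ENNReal.ofReal (C * ν k ^ (-ρ q)) := by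
  rcases eq_or_ne q ⊤ with rfl | htop
  · refine ⟨100, by norm_num, fun k => (eLpNorm_e_top_le k).trans (le_of_eq ?_)⟩
    simp [ρ]
  lift q to NNReal using htop
  have hq2 : (2 : ℝ) ≤ q := by exact_mod_cast hq
  have hq4' : (q : ℝ) ≠ 4 := by exact_mod_cast hq4
  have hq0 : (0 : ℝ) < q := by linarith
  have hinv : ((q : ENNReal)⁻¹).toReal = 1 / (q : ℝ) := by
    rw [ENNReal.toReal_inv]; simp
  have hcoe : ENNReal.ofReal (q : ℝ) = q := ENNReal.ofReal_coe_nnreal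
  have key : ∃ C : ℝ, 0 < C ∧ ∀ k, ∫⁻ z in Ioi 0, ENNReal.ofReal (|laguerreFun k z| ^ (q : ℝ)) ≤
      ENNReal.ofReal (C * ν k ^ (-ρ q * q)) := by
    rcases lt_or_gt_of_ne hq4' with h | h
    · obtain ⟨C, hC, hb⟩ := lintegral_le_of_lt_four hq2 h
      refine ⟨C, hC, fun k => ?_⟩
      have : -ρ q * q = 1 - (q : ℝ) / 2 := by
        rw [ρ, hinv, min_eq_left]
        · field_simp; ring
        · rw [sub_le_iff_le_add, ← add_div, div_le_div_iff₀ (by norm_num) hq0]; linarith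
      rw [this]; exact hb k
    · obtain ⟨C, hC, hb⟩ := lintegral_le_of_four_lt h
      refine ⟨C, hC, fun k => ?_⟩
      have : -ρ q * q = -1 := by
        rw [ρ, hinv, min_eq_right]
        · field_simp
        · rw [le_sub_iff_add_le, ← add_div, div_le_div_iff₀ hq0 (by norm_num)]; linarith
      rw [this, Real.rpow_neg_one]; exact hb k
  obtain ⟨C, hC, hb⟩ := key
  refine ⟨(Real.pi * C) ^ (1 / (q : ℝ)), by positivity, fun k => ?_⟩
  have hν := ν_pos k
  have h := eLpNorm_e_le hq0 k (by positivity) (hb k)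
  rw [hcoe] at h
  refine h.trans (le_of_eq ?_)
  rw [← mul_assoc, Real.mul_rpow (by positivity) (by positivity), ← Real.rpow_mul hν.le,
    mul_assoc, mul_one_div_cancel hq0.ne', mul_one]

theorem eLpNorm_e_four_le :
    ∃ C : ℝ, 0 < C ∧ ∀ k : ℕ, eLpNorm (e k) 4 volume ≤
      ENNReal.ofReal (C * ν k ^ (-(1 / 4) : ℝ) * Real.log (ν k) ^ (1 / 4 : ℝ)) := by
  obtain ⟨C, hC, hb⟩ := lintegral_four_le
  refine ⟨(Real.pi * C) ^ (1 / 4 : ℝ), by positivity, fun k => ?_⟩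
  have hν := ν_pos k
  have hl := log_ν_pos k
  have h := eLpNorm_e_le (by norm_num) k (by positivity) (hb k)
  rw [show ENNReal.ofReal (4 : ℝ) = 4 by norm_num] at h
  refine h.trans (le_of_eq ?_)
  rw [← mul_assoc, Real.mul_rpow (by positivity) (by positivity),
    Real.mul_rpow (inv_nonneg.2 hν.le) hl.le, Real.inv_rpow hν.le, Real.rpow_neg hν.le,
    mul_assoc ((Real.pi * C) ^ (1 / 4 : ℝ))]

/-! ### Coefficients of power series -/

lemma integral_exp_int_mul (n : ℤ) :
    ∫ θ in (0 : ℝ)..(2 * Real.pi), Complex.exp (n * Complex.I * θ) =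
      if n = 0 then (2 * Real.pi : ℂ) else 0 := by
  split_ifs with h
  · subst h; simp
  · have hc : (n : ℂ) * Complex.I ≠ 0 := mul_ne_zero (by exact_mod_cast h) Complex.I_ne_zero
    rw [integral_exp_mul_complex hc]
    have : (n : ℂ) * Complex.I * ((2 * Real.pi : ℝ) : ℂ) = n * (2 * Real.pi * Complex.I) := by
      push_cast; ring
    rw [this, Complex.exp_int_mul_two_pi_mul_I]
    simp

/-- Cauchy's estimate for the coefficients of a power series bounded on a circle. -/
lemma norm_coeff_mul_pow_le {a : ℕ → ℂ} {r B : ℝ} (hr : 0 ≤ r)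
    (hs : Summable fun m => ‖a m‖ * r ^ m)
    (hB : ∀ t : ℂ, ‖t‖ = r → ‖∑' m, a m * t ^ m‖ ≤ B) (k : ℕ) : ‖a k‖ * r ^ k ≤ B := by
  set u : ℝ → ℂ := fun θ => r * Complex.exp (Complex.I * θ) with hu
  have hun : ∀ θ, ‖u θ‖ = r := by
    intro θ
    rw [hu, norm_mul, mul_comm Complex.I, Complex.norm_exp_ofReal_mul_I]
    simp [abs_of_nonneg hr]
  have huc : Continuous u := by fun_prop
  let F : ℕ → C(ℝ, ℂ) := fun m =>
    ⟨fun θ => a m * u θ ^ m * Complex.exp (-(k * Complex.I * θ)), by fun_prop⟩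
  have hexp : ∀ θ : ℝ, ‖Complex.exp (-(k * Complex.I * θ))‖ = 1 := by
    intro θ
    have : -((k : ℂ) * Complex.I * θ) = ((-(k * θ) : ℝ) : ℂ) * Complex.I := by push_cast; ring
    rw [this, Complex.norm_exp_ofReal_mul_I]
  have hFn : ∀ m θ, ‖F m θ‖ = ‖a m‖ * r ^ m := by
    intro m θ
    simp only [F, ContinuousMap.coe_mk]
    rw [norm_mul, norm_mul, norm_pow, hun, hexp, mul_one]
  have hsum : HasSum (fun m => ∫ θ in (0 : ℝ)..(2 * Real.pi), F m θ)
      (∫ θ in (0 : ℝ)..(2 * Real.pi), ∑' m, F m θ) := by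
    refine intervalIntegral.hasSum_intervalIntegral_of_summable_norm (f := F) ?_
    refine Summable.of_nonneg_of_le (fun _ => norm_nonneg _) (fun m => ?_) hs
    rw [ContinuousMap.norm_le _ (by positivity)]
    intro x
    rw [ContinuousMap.restrict_apply, hFn]
  have hval : ∀ m, ∫ θ in (0 : ℝ)..(2 * Real.pi), F m θ =
      if m = k then 2 * Real.pi * (a k * r ^ k) else 0 := by
    intro m
    have h1 : ∀ θ : ℝ, F m θ = a m * r ^ m *
        Complex.exp (((m : ℤ) - (k : ℤ) : ℤ) * Complex.I * θ) := by
      intro θ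
      simp only [F, ContinuousMap.coe_mk, hu]
      have h2 : Complex.exp (((m : ℤ) - (k : ℤ) : ℤ) * Complex.I * θ) =
          Complex.exp (m * (Complex.I * θ)) * Complex.exp (-(k * Complex.I * θ)) := by
        rw [← Complex.exp_add]
        congr 1
        push_cast; ring
      rw [h2, mul_pow, ← Complex.exp_nat_mul]
      ring
    simp_rw [h1]
    rw [intervalIntegral.integral_const_mul, integral_exp_int_mul]
    by_cases h : m = k
    · subst h; simp; ring
    · rw [if_neg (by omega), if_neg h, mul_zero]
  simp_rw [hval] at hsum
  have heq := hsum.unique (hasSum_ite_eq k (2 * Real.pi * (a k * r ^ k) : ℂ))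
  have hbound : ‖∫ θ in (0 : ℝ)..(2 * Real.pi), ∑' m, F m θ‖ ≤ B * |2 * Real.pi - 0| := by
    refine intervalIntegral.norm_integral_le_of_norm_le_const fun θ _ => ?_
    simp only [F, ContinuousMap.coe_mk]
    rw [tsum_mul_right, norm_mul, hexp, mul_one]
    exact hB _ (hun θ)
  rw [heq, sub_zero, abs_of_pos (by positivity)] at hbound
  have hpi := Real.pi_pos
  simp only [norm_mul, norm_pow, Complex.norm_real, Real.norm_eq_abs, abs_of_nonneg hr,
    abs_of_pos hpi] at hbound
  norm_num at hbound
  nlinarith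

/-! ### Generating function -/

lemma hasSum_of_eq {ι E : Type*} [AddCommMonoid E] [TopologicalSpace E] {f g : ι → E} {a : E}
    (h : ∀ i, f i = g i) (hf : HasSum f a) : HasSum g a := (funext h) ▸ hf

lemma hasSum_antidiagonal {f : ℕ × ℕ → ℂ} {a : ℂ} (hf : HasSum f a) :
    HasSum (fun k => ∑ p ∈ Finset.HasAntidiagonal.antidiagonal k, f p) a := by
  have hσ := (Finset.HasAntidiagonal.sigmaAntidiagonalEquivProd.hasSum_iff (f := f)).2 hf
  refine hasSum_of_eq (fun k => ?_) (hσ.sigma fun k => hasSum_fintype _)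
  exact Finset.sum_coe_sort (Finset.HasAntidiagonal.antidiagonal k) f

lemma hasSum_lagPoly {t : ℂ} (ht : ‖t‖ < 1) (z : ℝ) :
    HasSum (fun k => (((lagPoly k).eval z : ℝ) : ℂ) * t ^ k)
      ((1 - t)⁻¹ * Complex.exp (-z * (t / (1 - t)))) := by
  have h1t : (1 - t) ≠ 0 := by
    intro h
    rw [sub_eq_zero] at h
    rw [← h] at ht; simp at ht
  let f : ℕ × ℕ → ℂ := fun p => (-z : ℂ) ^ p.1 / (p.1.factorial : ℂ) * t ^ p.1 *
    (((p.2 + p.1).choose p.1 : ℂ) * t ^ p.2)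
  have hcol : ∀ j, HasSum (fun n => f (j, n))
      ((-z : ℂ) ^ j / j.factorial * t ^ j * (1 / (1 - t) ^ (j + 1))) := fun j =>
    hasSum_of_eq (fun n => by simp only [f]) ((hasSum_choose_mul_geometric_of_norm_lt_one j
      ht).mul_left ((-z : ℂ) ^ j / j.factorial * t ^ j))
  have hsummable : Summable f := by
    have ht' : ‖(‖t‖ : ℝ)‖ < 1 := by simpa using ht
    have hcol' : ∀ j, HasSum (fun n => ‖f (j, n)‖)
        (|z| ^ j / j.factorial * ‖t‖ ^ j * (1 / (1 - ‖t‖) ^ (j + 1))) := by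
      intro j
      refine hasSum_of_eq (fun n => ?_) ((hasSum_choose_mul_geometric_of_norm_lt_one j
        ht').mul_left (|z| ^ j / j.factorial * ‖t‖ ^ j))
      simp [f]
    refine Summable.of_norm ((summable_prod_of_nonneg fun _ => norm_nonneg _).2
      ⟨fun j => (hcol' j).summable, ?_⟩)
    simp_rw [(hcol' _).tsum_eq]
    have := (Real.summable_pow_div_factorial (|z| * ‖t‖ / (1 - ‖t‖))).mul_right (1 / (1 - ‖t‖))
    refine this.congr fun j => ?_
    have : 1 - ‖t‖ ≠ 0 := by linarith
    rw [div_pow, mul_pow, pow_succ]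
    field_simp
  have hcols : HasSum (fun j => (-z : ℂ) ^ j / j.factorial * t ^ j * (1 / (1 - t) ^ (j + 1)))
      ((1 - t)⁻¹ * Complex.exp (-z * (t / (1 - t)))) := by
    have := (NormedSpace.expSeries_div_hasSum_exp (-z * (t / (1 - t)) : ℂ)).mul_left (1 - t)⁻¹
    rw [← Complex.exp_eq_exp_ℂ] at this
    refine hasSum_of_eq (fun j => ?_) this
    rw [mul_pow, div_pow, pow_succ]
    field_simp
  have hf : HasSum f ((1 - t)⁻¹ * Complex.exp (-z * (t / (1 - t)))) := by
    have := hsummable.hasSum.prod_fiberwise hcol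
    rw [hcols.unique this]
    exact hsummable.hasSum
  refine hasSum_of_eq (fun k => ?_) (hasSum_antidiagonal hf)
  rw [lagPoly_eval,
    Finset.Nat.sum_antidiagonal_eq_sum_range_succ_mk]
  push_cast
  rw [Finset.sum_mul]
  refine Finset.sum_congr rfl fun j hj => ?_
  have hj' : j ≤ k := by simpa [Nat.lt_succ_iff] using hj
  simp only [f]
  rw [Nat.sub_add_cancel hj']
  have : t ^ k = t ^ j * t ^ (k - j) := by rw [← pow_add]; congr 1; omega
  rw [this]; ring

/-- The generating function of the Laguerre functions. -/
lemma hasSum_laguerreFun {t : ℂ} (ht : ‖t‖ < 1) (z : ℝ) :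
    HasSum (fun k => (laguerreFun k z : ℂ) * t ^ k)
      ((1 - t)⁻¹ * Complex.exp (-((1 + t) / (1 - t)) * z / 2)) := by
  have h1t : (1 - t) ≠ 0 := by
    intro h
    rw [sub_eq_zero] at h
    rw [← h] at ht; simp at ht
  have h := (hasSum_lagPoly ht z).mul_left (Complex.exp (-z / 2))
  have e1 : Complex.exp (-z / 2) * ((1 - t)⁻¹ * Complex.exp (-z * (t / (1 - t)))) =
      (1 - t)⁻¹ * Complex.exp (-((1 + t) / (1 - t)) * z / 2) := by
    rw [mul_left_comm, ← Complex.exp_add]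
    congr 2
    field_simp
    ring
  rw [← e1]
  refine hasSum_of_eq (fun k => ?_) h
  rw [laguerreFun_eq]
  push_cast
  ring

/-! ### Laplace transform -/

lemma integrableOn_pow_mul_exp (j : ℕ) {a : ℝ} (ha : 0 < a) :
    IntegrableOn (fun z : ℝ => z ^ j * Real.exp (-a * z)) (Ioi 0) := by
  have := integrableOn_rpow_mul_exp_neg_mul_rpow (s := (j : ℝ)) (p := 1) (b := a)
    (by linarith [(Nat.cast_nonneg j : (0 : ℝ) ≤ j)]) one_pos ha
  simpa using this

lemma integrableOn_laguerreFun (k : ℕ) : IntegrableOn (laguerreFun k) (Ioi 0) := by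
  have h : laguerreFun k = fun z => ∑ j ∈ Finset.range ((lagPoly k).natDegree + 1),
      (lagPoly k).coeff j * (z ^ j * Real.exp (-(1 / 2) * z)) := by
    funext z
    rw [laguerreFun_eq, Polynomial.eval_eq_sum_range, Finset.mul_sum]
    refine Finset.sum_congr rfl fun j _ => ?_
    rw [show -(1 / 2) * z = -z / 2 by ring]; ring
  rw [h]
  exact integrable_finsetSum _ fun j _ =>
    (integrableOn_pow_mul_exp j (by norm_num : (0 : ℝ) < 1 / 2)).const_mul _

lemma norm_exp_neg_mul (a : ℂ) (z : ℝ) : ‖Complex.exp (-a * z)‖ = Real.exp (-a.re * z) := by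
  rw [Complex.norm_exp]; simp

lemma integrableOn_pow_mul_cexp (j : ℕ) {a : ℂ} (ha : 0 < a.re) :
    IntegrableOn (fun z : ℝ => (z : ℂ) ^ j * Complex.exp (-a * z)) (Ioi 0) := by
  refine Integrable.mono' (integrableOn_pow_mul_exp j ha) ?_ ?_
  · exact (by fun_prop : Continuous fun z : ℝ => (z : ℂ) ^ j * Complex.exp (-a * z)).aestronglyMeasurable
  · filter_upwards [ae_restrict_mem measurableSet_Ioi] with z hz
    have hz' : (0 : ℝ) < z := hz
    rw [norm_mul, norm_pow, norm_exp_neg_mul, Complex.norm_real, Real.norm_eq_abs, abs_of_pos hz']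

lemma integral_pow_mul_cexp (j : ℕ) {a : ℂ} (ha : 0 < a.re) :
    ∫ z : ℝ in Ioi 0, (z : ℂ) ^ j * Complex.exp (-a * z) = j.factorial / a ^ (j + 1) := by
  have ha0 : a ≠ 0 := by rintro rfl; simp at ha
  have hderiv : ∀ z : ℝ, HasDerivAt (fun z : ℝ => Complex.exp (-a * z))
      (Complex.exp (-a * z) * (-a)) z := by
    intro z
    have := ((hasDerivAt_id (z : ℂ)).const_mul (-a)).cexp.comp_ofReal
    simpa using this
  induction j with
  | zero =>
    have h := integral_exp_mul_complex_Ioi (a := -a) (by simpa using ha) 0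
    simp only [pow_zero, one_mul, zero_add, pow_one, Nat.factorial_zero]
    rw [h]; simp
  | succ j ih =>
    have hd : ∀ z ∈ Ioi (0 : ℝ), HasDerivAt (fun z : ℝ => (z : ℂ) ^ (j + 1) * Complex.exp (-a * z))
        ((j + 1) * ((z : ℂ) ^ j * Complex.exp (-a * z)) -
          a * ((z : ℂ) ^ (j + 1) * Complex.exp (-a * z))) z := by
      intro z _
      have h1 : HasDerivAt (fun z : ℝ => (z : ℂ) ^ (j + 1)) ((j + 1) * (z : ℂ) ^ j) z := by
        have := (hasDerivAt_pow (j + 1) (z : ℂ)).comp_ofReal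
        simpa using this
      refine (h1.mul (hderiv z)).congr_deriv ?_
      ring
    have ht : Filter.Tendsto (fun z : ℝ => (z : ℂ) ^ (j + 1) * Complex.exp (-a * z))
        Filter.atTop (nhds 0) := by
      rw [tendsto_zero_iff_norm_tendsto_zero]
      have := tendsto_rpow_mul_exp_neg_mul_atTop_nhds_zero ((j + 1 : ℕ) : ℝ) a.re ha
      refine this.congr' ?_
      filter_upwards [Filter.eventually_gt_atTop 0] with z hz
      rw [norm_mul, norm_pow, norm_exp_neg_mul, Complex.norm_real, Real.norm_eq_abs,
        abs_of_pos hz, Real.rpow_natCast]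
    have hc : ContinuousWithinAt (fun z : ℝ => (z : ℂ) ^ (j + 1) * Complex.exp (-a * z))
        (Ici 0) 0 := by
      have : Continuous (fun z : ℝ => (z : ℂ) ^ (j + 1) * Complex.exp (-a * z)) := by fun_prop
      exact this.continuousWithinAt
    have i1 := (integrableOn_pow_mul_cexp j ha).const_mul ((j : ℂ) + 1)
    have i2 := (integrableOn_pow_mul_cexp (j + 1) ha).const_mul a
    have h := integral_Ioi_of_hasDerivAt_of_tendsto hc hd (i1.sub i2) ht
    have h2 := integral_sub i1 i2
    rw [h2, integral_const_mul, integral_const_mul, ih] at h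
    simp only [Complex.ofReal_zero, zero_pow (Nat.succ_ne_zero j), zero_mul, sub_zero] at h
    rw [sub_eq_zero] at h
    rw [← mul_right_inj' ha0, ← h, Nat.factorial_succ]
    push_cast
    field_simp
    ring

/-- The Laplace transform of a Laguerre function. -/
lemma integral_cexp_mul_laguerreFun (n : ℕ) {S : ℂ} (hS : 0 ≤ S.re) :
    ∫ z : ℝ in Ioi 0, Complex.exp (-S * z / 2) * (laguerreFun n z : ℂ) =
      2 / (S + 1) * ((S - 1) / (S + 1)) ^ n := by
  have hS1 : S + 1 ≠ 0 := by
    intro h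
    have := congrArg Complex.re h
    simp at this; linarith
  have ha : 0 < ((S + 1) / 2).re := by simp; linarith
  have h : ∀ z : ℝ, Complex.exp (-S * z / 2) * (laguerreFun n z : ℂ) =
      ∑ j ∈ Finset.range (n + 1), (n.choose j : ℂ) * (-1) ^ j / j.factorial *
        ((z : ℂ) ^ j * Complex.exp (-((S + 1) / 2) * z)) := by
    intro z
    have e1 : Complex.exp (-((S + 1) / 2) * z) =
        Complex.exp (-S * z / 2) * Complex.exp (-z / 2) := by
      rw [← Complex.exp_add]; congr 1; ring
    rw [laguerreFun_eq, lagPoly_eval]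
    push_cast
    rw [Finset.mul_sum, Finset.mul_sum]
    refine Finset.sum_congr rfl fun j _ => ?_
    rw [e1, neg_pow (z : ℂ)]; ring
  simp_rw [h]
  rw [integral_finsetSum _ fun j _ => (integrableOn_pow_mul_cexp j ha).const_mul _]
  have e2 : (S - 1) / (S + 1) = -(2 / (S + 1)) + 1 := by field_simp; ring
  rw [e2, add_pow, Finset.mul_sum]
  refine Finset.sum_congr rfl fun j _ => ?_
  rw [integral_const_mul, integral_pow_mul_cexp j ha, neg_pow (2 / (S + 1))]
  have : (j.factorial : ℂ) ≠ 0 := by exact_mod_cast j.factorial_ne_zero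
  rw [one_pow, div_pow, div_pow, pow_succ, pow_succ]
  field_simp

/-! ### Geometry of the Cayley transform -/

/-- The Cayley transform `t ↦ (1 + t) / (1 - t)` sends the circle `|t| = r` to the circle with
centre `(1 + r²) / (1 - r²)` and radius `2 r / (1 - r²)`. -/
lemma norm_cayley_sub {t : ℂ} {r : ℝ} (hr : r < 1) (ht : ‖t‖ = r) :
    ‖(1 + t) / (1 - t) - ((1 + r ^ 2) / (1 - r ^ 2) : ℝ)‖ = 2 * r / (1 - r ^ 2) := by
  have hr0 : 0 ≤ r := ht ▸ norm_nonneg t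
  have h1t : (1 - t) ≠ 0 := by
    intro h
    rw [sub_eq_zero] at h
    rw [← h] at ht; simp at ht; linarith
  have hr2 : 0 < 1 - r ^ 2 := by nlinarith
  have hr2' : (1 - (r : ℂ) ^ 2) ≠ 0 := by exact_mod_cast hr2.ne'
  have hc : (r : ℂ) ^ 2 = t * (starRingEnd ℂ) t := by
    rw [Complex.mul_conj, Complex.normSq_eq_norm_sq, ht]; push_cast; rfl
  have e1 : (1 + t) / (1 - t) - ((1 + r ^ 2) / (1 - r ^ 2) : ℝ) =
      2 * t * (starRingEnd ℂ) (1 - t) / ((1 - t) * ((1 - r ^ 2 : ℝ) : ℂ)) := by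
    push_cast
    rw [map_sub, map_one]
    field_simp
    rw [hc]; ring
  rw [e1, norm_div, norm_mul, norm_mul, norm_mul, Complex.norm_conj, Complex.norm_real,
    Real.norm_eq_abs, abs_of_pos hr2, ht]
  have : ‖1 - t‖ ≠ 0 := norm_ne_zero_iff.2 h1t
  simp
  field_simp

/-- A disc `|S - m c| ≤ m ρ`, where `c = (a + 1/a) / 2` and `ρ = (a - 1/a) / 2`, meets the real
axis in `[m/a, m a]`, so its inverse Cayley transform lies in the disc of radius
`(m a - 1) / (m a + 1)`. -/
lemma norm_sub_one_le {S : ℂ} {a m : ℝ} (ha : 1 < a) (hm : 1 ≤ m)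
    (hS : ‖S - (m * ((a + 1 / a) / 2) : ℝ)‖ ≤ m * ((a - 1 / a) / 2)) :
    ‖S - 1‖ ≤ (m * a - 1) / (m * a + 1) * ‖S + 1‖ := by
  have ha0 : 0 < a := by linarith
  have hma : 1 ≤ m * a := by nlinarith
  have hx := Complex.abs_re_le_norm (S - (m * ((a + 1 / a) / 2) : ℝ))
  have hsq : ‖S - (m * ((a + 1 / a) / 2) : ℝ)‖ ^ 2 ≤ (m * ((a - 1 / a) / 2)) ^ 2 := by gcongr
  rw [← Complex.normSq_eq_norm_sq, Complex.normSq_apply] at hsq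
  simp only [Complex.sub_re, Complex.sub_im, Complex.ofReal_re, Complex.ofReal_im, sub_zero]
    at hx hsq
  have hxle : S.re ≤ m * a := by
    have := (abs_le.1 (hx.trans hS)).2
    linarith
  have hK : S.re ^ 2 + S.im ^ 2 + 1 ≤ (m * a + 1 / (m * a)) * S.re := by
    have h1 : S.re ^ 2 + S.im ^ 2 + m ^ 2 ≤ (m * a + m / a) * S.re := by
      have : a * (1 / a) = 1 := by field_simp
      have h3 : m / a = m * (1 / a) := by ring
      rw [h3]
      nlinarith
    have h2 : 0 ≤ (m ^ 2 - 1) * (1 - S.re / (m * a)) := by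
      refine mul_nonneg (by nlinarith) ?_
      rw [sub_nonneg, div_le_one (by positivity)]; exact hxle
    have h3 : (m * a + m / a) * S.re - m ^ 2 + (m ^ 2 - 1) * (1 - S.re / (m * a)) =
        (m * a + 1 / (m * a)) * S.re - 1 := by
      field_simp; ring
    linarith
  have hr0 : 0 ≤ (m * a - 1) / (m * a + 1) := div_nonneg (by linarith) (by linarith)
  refine le_of_pow_le_pow_left₀ (n := 2) (by norm_num) (by positivity) ?_
  rw [mul_pow, ← Complex.normSq_eq_norm_sq, ← Complex.normSq_eq_norm_sq, Complex.normSq_apply,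
    Complex.normSq_apply, div_pow, div_mul_eq_mul_div, le_div_iff₀ (by positivity)]
  simp only [Complex.sub_re, Complex.sub_im, Complex.add_re, Complex.add_im, Complex.one_re,
    Complex.one_im, sub_zero, add_zero]
  have hK' : (S.re ^ 2 + S.im ^ 2 + 1) * (m * a) ≤ ((m * a) ^ 2 + 1) * S.re := by
    calc _ ≤ (m * a + 1 / (m * a)) * S.re * (m * a) := by gcongr
      _ = _ := by field_simp
  nlinarith

/-! ### The contour estimate -/

/-- The product of the Laguerre functions with indices in a list. -/
noncomputable def lagProd (L : List ℕ) (z : ℝ) : ℝ := (L.map fun k => laguerreFun k z).prod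

lemma continuous_lagProd (L : List ℕ) : Continuous (lagProd L) := by
  induction L with
  | nil =>
    have : lagProd [] = fun _ => 1 := by funext z; simp [lagProd]
    rw [this]; exact continuous_const
  | cons k L ih =>
    have : lagProd (k :: L) = fun z => laguerreFun k z * lagProd L z := by
      funext z; simp [lagProd]
    rw [this]
    exact (continuous_laguerreFun k).mul ih

lemma abs_lagProd_le (L : List ℕ) {z : ℝ} (hz : 0 ≤ z) : |lagProd L z| ≤ 100 ^ L.length := by
  induction L with
  | nil => simp [lagProd]
  | cons k L ih =>
    have : lagProd (k :: L) z = laguerreFun k z * lagProd L z := by simp [lagProd]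
    rw [this, abs_mul, List.length_cons, pow_succ']
    exact mul_le_mul (abs_laguerreFun_le k hz) ih (abs_nonneg _) (by norm_num)

/-- The integrand damped by `exp (-S z / 2)`. -/
noncomputable def damped (L : List ℕ) (n : ℕ) (S : ℂ) (z : ℝ) : ℂ :=
  Complex.exp (-S * z / 2) * ((lagProd L z * laguerreFun n z : ℝ) : ℂ)

lemma continuous_damped (L : List ℕ) (n : ℕ) (S : ℂ) : Continuous (damped L n S) := by
  have := continuous_lagProd L
  have := continuous_laguerreFun n
  unfold damped
  fun_prop

lemma integrableOn_damped (L : List ℕ) (n : ℕ) {S : ℂ} (hS : 0 ≤ S.re) :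
    IntegrableOn (damped L n S) (Ioi 0) := by
  refine Integrable.mono' ((integrableOn_laguerreFun n).norm.const_mul (100 ^ L.length))
    (continuous_damped L n S).aestronglyMeasurable ?_
  filter_upwards [ae_restrict_mem measurableSet_Ioi] with z hz
  have hz' : (0 : ℝ) < z := hz
  have h1 : ‖Complex.exp (-S * z / 2)‖ ≤ 1 := by
    rw [Complex.norm_exp, Real.exp_le_one_iff]
    have : (-S * z / 2).re = -(S.re * z / 2) := by simp; ring
    rw [this]
    have : 0 ≤ S.re * z := by positivity
    linarith
  unfold damped
  rw [norm_mul, Complex.norm_real, norm_mul, Real.norm_eq_abs (lagProd L z)]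
  calc _ ≤ 1 * (|lagProd L z| * ‖laguerreFun n z‖) := by gcongr
    _ ≤ _ := by
      rw [one_mul]
      gcongr
      exact abs_lagProd_le L hz'.le

lemma hasSum_integral_damped (L : List ℕ) (n : ℕ) {S t : ℂ} (hS : 0 ≤ S.re) (ht : ‖t‖ < 1) :
    HasSum (fun k => (∫ z in Ioi 0, damped (k :: L) n S z) * t ^ k)
      ((1 - t)⁻¹ * ∫ z in Ioi 0, damped L n (S + (1 + t) / (1 - t)) z) := by
  have hcons : ∀ k (z : ℝ), damped (k :: L) n S z = laguerreFun k z * damped L n S z := by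
    intro k z
    simp only [damped, lagProd, List.map_cons, List.prod_cons]
    push_cast; ring
  have hi := integrableOn_damped L n hS
  have hint : ∀ k, Integrable (fun z => damped (k :: L) n S z * t ^ k)
      (volume.restrict (Ioi 0)) := fun k => (integrableOn_damped (k :: L) n hS).mul_const _
  have hle : ∀ k, ∫ z in Ioi 0, ‖damped (k :: L) n S z * t ^ k‖ ≤
      100 * (∫ z in Ioi 0, ‖damped L n S z‖) * ‖t‖ ^ k := by
    intro k
    rw [← integral_const_mul, ← integral_mul_const]
    refine setIntegral_mono_on (hint k).norm ((hi.norm.const_mul _).mul_const _) measurableSet_Ioi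
      fun z hz => ?_
    have hz' : (0 : ℝ) < z := hz
    rw [norm_mul, norm_pow, hcons, norm_mul, Complex.norm_real, Real.norm_eq_abs]
    gcongr
    exact abs_laguerreFun_le k hz'.le
  have h := hasSum_integral_of_summable_integral_norm hint
    (Summable.of_nonneg_of_le (fun k => integral_nonneg fun z => norm_nonneg _) hle
      ((summable_geometric_of_lt_one (norm_nonneg t) ht).mul_left _))
  simp_rw [integral_mul_const] at h
  have e1 : (fun z => ∑' k, damped (k :: L) n S z * t ^ k) =
      fun z => (1 - t)⁻¹ * damped L n (S + (1 + t) / (1 - t)) z := by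
    funext z
    have h2 := ((hasSum_laguerreFun ht z).mul_left (damped L n S z)).tsum_eq
    have e2 : ∀ k, damped (k :: L) n S z * t ^ k =
      damped L n S z * ((laguerreFun k z : ℂ) * t ^ k) := by
      intro k; rw [hcons]; ring
    simp_rw [e2]
    rw [h2]
    unfold damped
    have e3 : Complex.exp (-(S + (1 + t) / (1 - t)) * z / 2) =
      Complex.exp (-S * z / 2) * Complex.exp (-((1 + t) / (1 - t)) * z / 2) := by
      rw [← Complex.exp_add]; congr 1; ring
    rw [e3]; ring
  rw [e1, integral_const_mul] at h
  exact h

/-- Removing the factors one at a time by Cauchy's estimate on the circle `|t| = r`,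
`r = (a - 1) / (a + 1)`: every removal adds to `S` a point of the circle with diameter
`[1/a, a]`. -/
lemma norm_integral_damped_le {a : ℝ} (ha : 1 < a) {m : ℕ} (hm : 1 ≤ m) (K n : ℕ) :
    ∀ (L : List ℕ) (j : ℕ), (∀ k ∈ L, k ≤ K) → j + L.length = m → ∀ S : ℂ,
      ‖S - (j * ((a + 1 / a) / 2) : ℝ)‖ ≤ j * ((a - 1 / a) / 2) →
      ‖∫ z in Ioi 0, damped L n S z‖ ≤
        ((a + 1) / 2 * (((a + 1) / (a - 1)) ^ K)) ^ L.length *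
          (2 * ((m * a - 1) / (m * a + 1)) ^ n) := by
  have ha0 : 0 < a := by linarith
  have hre : ∀ (j : ℕ) (S : ℂ), ‖S - (j * ((a + 1 / a) / 2) : ℝ)‖ ≤ j * ((a - 1 / a) / 2) →
      0 ≤ S.re := by
    intro j S hS
    have h1 := (abs_le.1 ((Complex.abs_re_le_norm _).trans hS)).1
    simp only [Complex.sub_re, Complex.ofReal_re] at h1
    have : 0 ≤ (j : ℝ) * (1 / a) := by positivity
    linarith
  intro L
  induction L with
  | nil =>
    intro j _ hj S hS
    have hj' : j = m := by simpa using hj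
    subst hj'
    have hm' : (1 : ℝ) ≤ j := by exact_mod_cast hm
    have hS0 := hre j S hS
    have h := norm_sub_one_le ha hm' hS
    have hS1 : 1 ≤ ‖S + 1‖ := by
      have := (le_abs_self _).trans (Complex.abs_re_le_norm (S + 1))
      simp at this; linarith
    have e : ∫ z in Ioi 0, damped [] n S z = 2 / (S + 1) * ((S - 1) / (S + 1)) ^ n := by
      rw [← integral_cexp_mul_laguerreFun n hS0]
      simp [damped, lagProd]
    rw [e, norm_mul, norm_pow, norm_div, norm_div]
    simp only [List.length_nil, pow_zero, one_mul]
    have h2 : ‖(2 : ℂ)‖ / ‖S + 1‖ ≤ 2 := by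
      simp only [Complex.norm_ofNat]
      exact div_le_self (by norm_num) hS1
    have h3 : ‖S - 1‖ / ‖S + 1‖ ≤ (j * a - 1) / (j * a + 1) := by
      rw [div_le_iff₀ (by linarith)]; exact h
    gcongr
  | cons k L ih =>
    intro j hL hj S hS
    have hk : k ≤ K := hL k (by simp)
    have hL' : ∀ k ∈ L, k ≤ K := fun k hk => hL k (by simp [hk])
    have hj' : (j + 1) + L.length = m := by rw [← hj, List.length_cons]; ring
    have hS0 := hre j S hS
    set r : ℝ := (a - 1) / (a + 1) with hr
    have hr0 : 0 < r := div_pos (by linarith) (by linarith)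
    have hr1 : r < 1 := by rw [hr, div_lt_one (by linarith)]; linarith
    set B := ((a + 1) / 2 * (((a + 1) / (a - 1)) ^ K)) ^ L.length *
          (2 * (((m : ℝ) * a - 1) / (m * a + 1)) ^ n) with hB
    have hm' : (1 : ℝ) ≤ m := by exact_mod_cast hm
    have hB0 : 0 ≤ B := by
      have h1 : 0 ≤ (m : ℝ) * a - 1 := by nlinarith
      have h2 : 0 ≤ a - 1 := by linarith
      positivity
    have hcenter : (1 + r ^ 2) / (1 - r ^ 2) = (a + 1 / a) / 2 := by
      have h1 : 1 - r ^ 2 = 4 * a / (a + 1) ^ 2 := by rw [hr]; field_simp; ring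
      rw [h1, hr]; field_simp; ring
    have hradius : 2 * r / (1 - r ^ 2) = (a - 1 / a) / 2 := by
      have h1 : 1 - r ^ 2 = 4 * a / (a + 1) ^ 2 := by rw [hr]; field_simp; ring
      rw [h1, hr]; field_simp; ring
    have hsum : Summable fun q => ‖∫ z in Ioi 0, damped (q :: L) n S z‖ * r ^ q := by
      have h := (hasSum_integral_damped L n (t := (r : ℂ)) hS0
        (by simpa [abs_of_pos hr0] using hr1)).summable.norm
      simpa [abs_of_pos hr0] using h
    have hbound : ∀ t : ℂ, ‖t‖ = r →
        ‖∑' q, (∫ z in Ioi 0, damped (q :: L) n S z) * t ^ q‖ ≤ (a + 1) / 2 * B := by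
      intro t ht
      rw [(hasSum_integral_damped L n hS0 (ht ▸ hr1)).tsum_eq, norm_mul, norm_inv]
      have h1t : 1 - r ≤ ‖1 - t‖ := by
        have := norm_sub_norm_le 1 t
        simpa [ht] using this
      have h1r : 1 - r = 2 / (a + 1) := by rw [hr]; field_simp; ring
      have h2 : ‖1 - t‖⁻¹ ≤ (a + 1) / 2 := by
        rw [show (a + 1) / 2 = (2 / (a + 1))⁻¹ by rw [inv_div], ← h1r]
        exact inv_anti₀ (by linarith) h1t
      have h3 := ih (j + 1) hL' hj' (S + (1 + t) / (1 - t)) (by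
        have e : S + (1 + t) / (1 - t) - (((j + 1 : ℕ) : ℝ) * ((a + 1 / a) / 2) : ℝ) =
          (S - (j * ((a + 1 / a) / 2) : ℝ)) +
            ((1 + t) / (1 - t) - (((a + 1 / a) / 2) : ℝ)) := by push_cast; ring
        rw [e]
        refine (norm_add_le _ _).trans ?_
        have h4 := norm_cayley_sub hr1 ht
        rw [hcenter, hradius] at h4
        rw [h4, Nat.cast_succ]
        linarith)
      gcongr
    have h := norm_coeff_mul_pow_le hr0.le hsum hbound k
    have hrk : r ^ K ≤ r ^ k := pow_le_pow_of_le_one hr0.le hr1.le hk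
    have h5 : ‖∫ z in Ioi 0, damped (k :: L) n S z‖ * r ^ K ≤ (a + 1) / 2 * B :=
      (mul_le_mul_of_nonneg_left hrk (norm_nonneg _)).trans h
    rw [← le_div_iff₀ (by positivity)] at h5
    refine h5.trans (le_of_eq ?_)
    have h6 : ((a + 1) / (a - 1)) ^ K = (r ^ K)⁻¹ := by rw [← inv_pow, hr, inv_div]
    rw [hB, List.length_cons, pow_succ, h6]
    field_simp

/-! ### Products of Laguerre functions -/

lemma prod_eq_lagProd {m : ℕ} (n : Fin (m + 1) → ℕ) (z : ℝ) :
    ∏ i, laguerreFun (n i) z =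
      lagProd (List.ofFn fun i : Fin m => n i.succ) z * laguerreFun (n 0) z := by
  rw [Fin.prod_univ_succ, mul_comm, lagProd, List.map_ofFn, List.prod_ofFn]
  rfl

lemma continuous_prod_laguerreFun {l : ℕ} (n : Fin l → ℕ) :
    Continuous fun z => ∏ i, laguerreFun (n i) z :=
  continuous_finsetProd _ fun i _ => continuous_laguerreFun (n i)

lemma integrableOn_prod_laguerreFun {m : ℕ} (n : Fin (m + 1) → ℕ) :
    IntegrableOn (fun z => ∏ i, laguerreFun (n i) z) (Ioi 0) := by
  refine Integrable.mono' ((integrableOn_laguerreFun (n 0)).norm.const_mul (100 ^ m))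
    (continuous_prod_laguerreFun n).aestronglyMeasurable ?_
  filter_upwards [ae_restrict_mem measurableSet_Ioi] with z hz
  have hz' : (0 : ℝ) < z := hz
  rw [prod_eq_lagProd, norm_mul, Real.norm_eq_abs]
  gcongr
  simpa using abs_lagProd_le (List.ofFn fun i : Fin m => n i.succ) hz'.le

lemma prod_e_eq {l : ℕ} (n : Fin l → ℕ) (x : EuclideanSpace ℝ (Fin 2)) :
    ∏ i, e (n i) x = (1 / √Real.pi) ^ l * ∏ i, laguerreFun (n i) (‖x‖ ^ 2) := by
  simp only [e, Finset.prod_mul_distrib, Finset.prod_const, Finset.card_univ, Fintype.card_fin]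

lemma integrable_prod_e {m : ℕ} (n : Fin (m + 1) → ℕ) :
    Integrable (fun x : EuclideanSpace ℝ (Fin 2) => ∏ i, e (n i) x) := by
  simp_rw [prod_e_eq]
  exact (integrable_norm_sq (continuous_prod_laguerreFun n)
    (integrableOn_prod_laguerreFun n)).const_mul _

lemma abs_integral_prod_e_le {l : ℕ} (n : Fin l → ℕ) :
    |∫ x : EuclideanSpace ℝ (Fin 2), ∏ i, e (n i) x| ≤
      Real.pi * |∫ z in Ioi 0, ∏ i, laguerreFun (n i) z| := by
  have hpi := Real.pi_pos
  have h : 1 ≤ √Real.pi := Real.one_le_sqrt.2 (by linarith [Real.pi_gt_three])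
  simp_rw [prod_e_eq]
  rw [integral_const_mul, integral_norm_sq _ (continuous_prod_laguerreFun n), abs_mul, abs_mul,
    abs_of_pos hpi, abs_of_nonneg (by positivity)]
  refine mul_le_of_le_one_left (by positivity) (pow_le_one₀ (by positivity) ?_)
  rw [div_le_one (by linarith)]
  exact h

/-! ### The exponential estimate -/

lemma AlmostDecreasing.mono {A A' : ℝ} (h : A ≤ A') {l : ℕ} {n : Fin l → ℕ}
    (hn : AlmostDecreasing A n) : AlmostDecreasing A' n := fun i hi =>
  (hn i hi).trans (mul_le_mul_of_nonneg_right h (ν_pos _).le)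

lemma AlmostDecreasing.le_pow {A : ℝ} (hA : 1 ≤ A) {l : ℕ} {n : Fin l → ℕ}
    (hn : AlmostDecreasing A n) (i : ℕ) : ∀ (j : ℕ) (hj : i + j < l),
      ν (n ⟨i + j, hj⟩) ≤ A ^ j * ν (n ⟨i, by omega⟩) := by
  intro j
  induction j with
  | zero => intro hj; simp
  | succ j ih =>
    intro hj
    calc _ ≤ A * ν (n ⟨i + j, by omega⟩) := hn (i + j) hj
      _ ≤ A * (A ^ j * ν (n ⟨i, by omega⟩)) := by gcongr; exact ih (by omega)
      _ = _ := by ring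

lemma abs_integral_prod_le_of_le {a : ℝ} (ha : 1 < a) {m : ℕ} (hm : 1 ≤ m) (K : ℕ)
    (n : Fin (m + 1) → ℕ) (hn : ∀ i : Fin m, n i.succ ≤ K) :
    |∫ z in Ioi 0, ∏ i, laguerreFun (n i) z| ≤
        ((a + 1) / 2 * (((a + 1) / (a - 1)) ^ K)) ^ m *
          (2 * ((m * a - 1) / (m * a + 1)) ^ (n 0)) := by
  have h := norm_integral_damped_le ha hm K (n 0) (List.ofFn fun i : Fin m => n i.succ) 0
    (by
      intro k hk
      rw [List.mem_ofFn] at hk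
      obtain ⟨i, rfl⟩ := hk
      exact hn i) (by simp) 0 (by simp)
  rw [List.length_ofFn] at h
  have e1 : ∫ z in Ioi 0, damped (List.ofFn fun i : Fin m => n i.succ) (n 0) 0 z =
      ((∫ z in Ioi 0, ∏ i, laguerreFun (n i) z : ℝ) : ℂ) := by
    rw [← integral_complex_ofReal]
    congr 1
    funext z
    rw [prod_eq_lagProd]
    simp [damped]
  rw [e1, Complex.norm_real, Real.norm_eq_abs] at h
  exact h

/-- The contour estimate with `a` comparable to `ν₂`: each removed factor costs `O(ν₂)`, and the
first factor contributes `(1 - c / ν₂) ^ n₁`. -/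
lemma abs_integral_prod_le_exp {m : ℕ} {A : ℝ} (hA : 1 ≤ A) :
    ∃ C c : ℝ, 0 < C ∧ 0 < c ∧ ∀ n : Fin (m + 1 + 1) → ℕ, AlmostDecreasing A n →
      |∫ z in Ioi 0, ∏ i, laguerreFun (n i) z| ≤
        C * ν (n ⟨1, by omega⟩) ^ (m + 1) *
          Real.exp (-(c * (ν (n ⟨0, by omega⟩) / ν (n ⟨1, by omega⟩)))) := by
  have hA0 : 0 < A := by linarith
  refine ⟨(A ^ (m + 1) * Real.exp 4) ^ (m + 1) * (2 * Real.exp 1),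
    1 / (4 * (((m + 1 : ℕ) : ℝ) * A ^ (m + 1))), by positivity, by positivity, fun n hn => ?_⟩
  set ν₂ := ν (n ⟨1, by omega⟩) with hν₂
  have h2 : 2 ≤ ν₂ := two_le_ν _
  have hA1 : 1 ≤ A ^ (m + 1) := one_le_pow₀ hA
  set a := A ^ (m + 1) * ν₂ with ha
  have ha2 : 2 ≤ a := by nlinarith
  have hm1 : (1 : ℝ) ≤ ((m + 1 : ℕ) : ℝ) := by exact_mod_cast Nat.succ_le_succ (Nat.zero_le m)
  have hK : ∀ i : Fin (m + 1), n i.succ ≤ ⌊a⌋₊ := by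
    intro i
    refine Nat.le_floor ?_
    have h := hn.le_pow hA 1 i.val (by omega)
    have e1 : (⟨1 + i.val, by omega⟩ : Fin (m + 1 + 1)) = i.succ := by
      ext; simp [add_comm]
    rw [e1] at h
    have h3 : A ^ i.val ≤ A ^ (m + 1) := pow_le_pow_right₀ hA (by omega)
    have h4 : ν (n i.succ) ≤ a := h.trans (by rw [ha]; gcongr)
    have h5 : (0 : ℝ) ≤ n i.succ := Nat.cast_nonneg _
    unfold ν at h4
    linarith
  have h := abs_integral_prod_le_of_le (by linarith : 1 < a) (Nat.le_add_left 1 m)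
    ⌊a⌋₊ n hK
  refine h.trans ?_
  have hpow : ((a + 1) / (a - 1)) ^ ⌊a⌋₊ ≤ Real.exp 4 := by
    have e1 : (a + 1) / (a - 1) = 2 / (a - 1) + 1 := by
      have : a - 1 ≠ 0 := by linarith
      field_simp; ring
    have h0 : 0 < 2 / (a - 1) := div_pos (by norm_num) (by linarith)
    calc _ ≤ (Real.exp (2 / (a - 1))) ^ ⌊a⌋₊ := by
          rw [e1]
          gcongr
          exact Real.add_one_le_exp _
      _ = Real.exp (⌊a⌋₊ * (2 / (a - 1))) := (Real.exp_nat_mul _ _).symm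
      _ ≤ Real.exp (a * (2 / (a - 1))) := by
          gcongr
          exact Nat.floor_le (by linarith)
      _ ≤ Real.exp 4 := by
          gcongr
          rw [← mul_div_assoc, div_le_iff₀ (by linarith)]
          linarith
  have hdec : ((((m + 1 : ℕ) : ℝ) * a - 1) / (((m + 1 : ℕ) : ℝ) * a + 1)) ^ (n 0) ≤
      Real.exp 1 * Real.exp (-(1 / (4 * (((m + 1 : ℕ) : ℝ) * A ^ (m + 1))) *
        (ν (n ⟨0, by omega⟩) / ν₂))) := by
    set D := ((m + 1 : ℕ) : ℝ) * a with hD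
    have hD2 : 2 ≤ D := by nlinarith
    have e1 : (D - 1) / (D + 1) = -(2 / (D + 1)) + 1 := by field_simp; ring
    have h0 : 0 ≤ (D - 1) / (D + 1) := div_nonneg (by linarith) (by linarith)
    have e2 : 1 / (4 * (((m + 1 : ℕ) : ℝ) * A ^ (m + 1))) * (ν (n ⟨0, by omega⟩) / ν₂) =
        ν (n 0) / (4 * D) := by
      rw [hD, ha]
      field_simp
      rfl
    rw [e2, ← Real.exp_add]
    calc _ ≤ (Real.exp (-(2 / (D + 1)))) ^ (n 0) := by
          gcongr
          rw [e1]; exact Real.add_one_le_exp _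
      _ = Real.exp (n 0 * (-(2 / (D + 1)))) := (Real.exp_nat_mul _ _).symm
      _ ≤ _ := by
          gcongr
          have h1 : (n 0 : ℝ) * (2 / (2 * D)) ≤ n 0 * (2 / (D + 1)) := by
            gcongr; linarith
          have h2 : (n 0 : ℝ) * (2 / (2 * D)) = ν (n 0) / (4 * D) - 1 / (2 * D) := by
            unfold ν; field_simp; ring
          have h3 : 1 / (2 * D) ≤ 1 := by
            rw [div_le_one (by linarith)]; linarith
          linarith
  have h1a : 0 ≤ (a + 1) / (a - 1) := div_nonneg (by linarith) (by linarith)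
  have hbase : 0 ≤ (((m + 1 : ℕ) : ℝ) * a - 1) / (((m + 1 : ℕ) : ℝ) * a + 1) :=
    div_nonneg (by nlinarith) (by nlinarith)
  have hbase' := mul_nonneg zero_le_two (pow_nonneg hbase (n 0))
  calc _ ≤ (a * Real.exp 4) ^ (m + 1) * (2 * (Real.exp 1 *
        Real.exp (-(1 / (4 * (((m + 1 : ℕ) : ℝ) * A ^ (m + 1))) *
        (ν (n ⟨0, by omega⟩) / ν₂))))) := by
        gcongr
        linarith
    _ = _ := by rw [ha]; ring

/-! ### Separated frequencies -/

/-- If `ν₂ ^ (1 + ε) ≲ ν₁`, then `ν₁ / ν₂` exceeds a power of `ν₁`, so the exponential estimate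
gives decay faster than any power of `ν₁`. -/
theorem abs_integral_prod_le_rpow_neg {m : ℕ} {A B ε : ℝ} (hB : 0 < B)
    (hε : 0 < ε) (N : ℝ) :
    ∃ C : ℝ, 0 < C ∧ ∀ n : Fin (m + 1 + 1) → ℕ, AlmostDecreasing A n →
      ν (n ⟨1, by omega⟩) ^ (1 + ε) ≤ B * ν (n ⟨0, by omega⟩) →
      |∫ z in Ioi 0, ∏ i, laguerreFun (n i) z| ≤ C * ν (n ⟨0, by omega⟩) ^ (-N) := by
  obtain ⟨C, c, hC, hc, hb⟩ := abs_integral_prod_le_exp (m := m) (le_max_right A 1)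
  set δ : ℝ := 1 - 1 / (1 + ε) with hδ
  have hδ0 : 0 < δ := by
    rw [hδ, sub_pos, div_lt_one (by linarith)]; linarith
  have hδ1 : 1 / (1 + ε) = 1 - δ := by rw [hδ]; ring
  set M : ℕ := ⌈(N + (m + 1 : ℕ)) / δ⌉₊ with hM
  have hMδ : N + (m + 1 : ℕ) ≤ M * δ := by
    rw [← div_le_iff₀ hδ0]; exact Nat.le_ceil _
  set D : ℝ := B ^ (1 / (1 + ε)) with hD
  have hD0 : 0 < D := Real.rpow_pos_of_pos hB _
  refine ⟨C * D ^ (m + 1) * (M.factorial * (D / c) ^ M), by positivity, fun n hn hsep => ?_⟩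
  refine (hb n (hn.mono (le_max_left A 1))).trans ?_
  generalize hν₁ : ν (n ⟨0, by omega⟩) = ν₁ at *
  generalize hν₂ : ν (n ⟨1, by omega⟩) = ν₂ at *
  have h1 : 2 ≤ ν₁ := hν₁ ▸ two_le_ν _
  have h2 : 2 ≤ ν₂ := hν₂ ▸ two_le_ν _
  have h10 : 0 < ν₁ := by linarith
  have h20 : 0 < ν₂ := by linarith
  have hle : ν₂ ≤ D * ν₁ ^ (1 - δ) := by
    calc ν₂ = (ν₂ ^ (1 + ε)) ^ (1 / (1 + ε)) := by
          rw [← Real.rpow_mul h20.le, mul_one_div_cancel (by linarith), Real.rpow_one]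
      _ ≤ (B * ν₁) ^ (1 / (1 + ε)) := Real.rpow_le_rpow (by positivity) hsep (by positivity)
      _ = D * ν₁ ^ (1 - δ) := by rw [Real.mul_rpow hB.le h10.le, ← hδ1]
  have hle1 : ν₂ ≤ D * ν₁ := by
    refine hle.trans ?_
    gcongr
    calc ν₁ ^ (1 - δ) ≤ ν₁ ^ (1 : ℝ) :=
          Real.rpow_le_rpow_of_exponent_le (by linarith) (by linarith)
      _ = ν₁ := Real.rpow_one _
  have hratio : ν₂ / ν₁ ≤ D * ν₁ ^ (-δ) := by
    rw [div_le_iff₀ h10]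
    refine hle.trans (le_of_eq ?_)
    rw [mul_assoc]
    congr 1
    nth_rewrite 3 [← Real.rpow_one ν₁]
    rw [← Real.rpow_add h10]; congr 1; ring
  have hexp : Real.exp (-(c * (ν₁ / ν₂))) ≤ M.factorial * (ν₂ / ν₁ / c) ^ M := by
    have hx : 0 < c * (ν₁ / ν₂) := by positivity
    have h3 := Real.pow_div_factorial_le_exp (c * (ν₁ / ν₂)) hx.le M
    have hf : (0 : ℝ) < M.factorial := by positivity
    rw [Real.exp_neg, show ν₂ / ν₁ / c = (c * (ν₁ / ν₂))⁻¹ by field_simp, inv_pow,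
      ← div_eq_mul_inv, inv_le_comm₀ (Real.exp_pos _) (by positivity), inv_div]
    exact h3
  have hpow : (ν₁ ^ (-δ)) ^ M * ν₁ ^ (m + 1) ≤ ν₁ ^ (-N) := by
    rw [← Real.rpow_natCast, ← Real.rpow_natCast, ← Real.rpow_mul h10.le, ← Real.rpow_add h10]
    refine Real.rpow_le_rpow_of_exponent_le (by linarith) ?_
    linarith
  calc _ ≤ C * (D * ν₁) ^ (m + 1) * (M.factorial * (D * ν₁ ^ (-δ) / c) ^ M) := by
        gcongr
        exact hexp.trans (by gcongr)
    _ = C * D ^ (m + 1) * (M.factorial * (D / c) ^ M) * ((ν₁ ^ (-δ)) ^ M * ν₁ ^ (m + 1)) := by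
        rw [mul_pow, div_pow, mul_pow, div_pow]; ring
    _ ≤ _ := by gcongr

/-! ### The general estimate -/

lemma integrableOn_laguerreFun_pow_four (k : ℕ) :
    IntegrableOn (fun z => laguerreFun k z ^ 4) (Ioi 0) := by
  have h := integrableOn_prod_laguerreFun (m := 3) fun _ => k
  simpa using h

lemma integral_laguerreFun_pow_four_le :
    ∃ C : ℝ, 0 < C ∧ ∀ k, ∫ z in Ioi 0, laguerreFun k z ^ 4 ≤
      C * ((ν k)⁻¹ * Real.log (ν k)) := by
  obtain ⟨C, hC, h⟩ := lintegral_four_le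
  refine ⟨C, hC, fun k => ?_⟩
  have hν := ν_pos k
  have hl := log_ν_pos k
  rw [← ENNReal.ofReal_le_ofReal_iff (by positivity),
    ofReal_integral_eq_lintegral_ofReal (integrableOn_laguerreFun_pow_four k)
      (Filter.Eventually.of_forall fun z => by positivity)]
  refine le_trans (le_of_eq ?_) (h k)
  refine lintegral_congr fun z => ?_
  congr 1
  rw [show (4 : ℝ) = ((4 : ℕ) : ℝ) by norm_num, Real.rpow_natCast, Even.pow_abs (by decide)]

lemma mul_le_sum_pow_four (a b c d : ℝ) :
    a * b * c * d ≤ (a ^ 4 + b ^ 4 + c ^ 4 + d ^ 4) / 4 := by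
  nlinarith [sq_nonneg (a * b - c * d), sq_nonneg (a ^ 2 - b ^ 2), sq_nonneg (c ^ 2 - d ^ 2)]

/-- Hölder's inequality for four factors, with the remaining factors bounded pointwise. -/
lemma abs_integral_prod_le_of_pow_four {k : ℕ} (n : Fin (k + 4) → ℕ) {x y z w : ℝ}
    (hx : 0 < x) (hy : 0 < y) (hz : 0 < z) (hw : 0 < w)
    (h0 : ∫ t in Ioi 0, laguerreFun (n 0) t ^ 4 ≤ x ^ 4)
    (h1 : ∫ t in Ioi 0, laguerreFun (n 1) t ^ 4 ≤ y ^ 4)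
    (h2 : ∫ t in Ioi 0, laguerreFun (n 2) t ^ 4 ≤ z ^ 4)
    (h3 : ∫ t in Ioi 0, laguerreFun (n 3) t ^ 4 ≤ w ^ 4) :
    |∫ t in Ioi 0, ∏ i, laguerreFun (n i) t| ≤ 100 ^ k * (x * y * z * w) := by
  have hi := fun j => integrableOn_laguerreFun_pow_four (n j)
  have hg : Integrable (fun t => 100 ^ k * (x * y * z * w) *
      ((laguerreFun (n 0) t ^ 4 / x ^ 4 + laguerreFun (n 1) t ^ 4 / y ^ 4 +
        laguerreFun (n 2) t ^ 4 / z ^ 4 + laguerreFun (n 3) t ^ 4 / w ^ 4) / 4))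
      (volume.restrict (Ioi 0)) :=
    ((((((hi 0).div_const _).add ((hi 1).div_const _)).add ((hi 2).div_const _)).add
      ((hi 3).div_const _)).div_const 4).const_mul _
  have hle := norm_integral_le_of_norm_le (f := fun t => ∏ i, laguerreFun (n i) t) hg (by
    filter_upwards [ae_restrict_mem measurableSet_Ioi] with t ht
    have ht' : (0 : ℝ) < t := ht
    have hr : |∏ i : Fin k, laguerreFun (n i.succ.succ.succ.succ) t| ≤ 100 ^ k := by
      rw [Finset.abs_prod]
      calc _ ≤ ∏ _i : Fin k, (100 : ℝ) := Finset.prod_le_prod (fun _ _ => abs_nonneg _)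
            fun i _ => abs_laguerreFun_le _ ht'.le
        _ = _ := by simp
    rw [Fin.prod_univ_succ, Fin.prod_univ_succ, Fin.prod_univ_succ, Fin.prod_univ_succ]
    have e1 : n (Fin.succ 0) = n 1 := rfl
    have e2 : n (Fin.succ (Fin.succ 0)) = n 2 := rfl
    have e3 : n (Fin.succ (Fin.succ (Fin.succ 0))) = n 3 := rfl
    rw [e1, e2, e3, Real.norm_eq_abs, abs_mul, abs_mul, abs_mul, abs_mul]
    have hm := mul_le_sum_pow_four (|laguerreFun (n 0) t| / x) (|laguerreFun (n 1) t| / y)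
      (|laguerreFun (n 2) t| / z) (|laguerreFun (n 3) t| / w)
    simp only [div_pow, Even.pow_abs (by decide : Even 4)] at hm
    calc _ = |∏ i : Fin k, laguerreFun (n i.succ.succ.succ.succ) t| * (x * y * z * w) *
          (|laguerreFun (n 0) t| / x * (|laguerreFun (n 1) t| / y) *
            (|laguerreFun (n 2) t| / z) * (|laguerreFun (n 3) t| / w)) := by field_simp
      _ ≤ _ := by gcongr)
  refine hle.trans ?_
  rw [integral_const_mul]
  refine mul_le_of_le_one_right (by positivity) ?_
  rw [integral_div, integral_add _ ((hi 3).div_const _), integral_add _ ((hi 2).div_const _),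
    integral_add ((hi 0).div_const _) ((hi 1).div_const _)]
  · simp only [integral_div]
    have q0 := (div_le_one (by positivity : 0 < x ^ 4)).2 h0
    have q1 := (div_le_one (by positivity : 0 < y ^ 4)).2 h1
    have q2 := (div_le_one (by positivity : 0 < z ^ 4)).2 h2
    have q3 := (div_le_one (by positivity : 0 < w ^ 4)).2 h3
    linarith
  · exact ((hi 0).div_const _).add ((hi 1).div_const _)
  · exact (((hi 0).div_const _).add ((hi 1).div_const _)).add ((hi 2).div_const _)

lemma half_le_log_ν (k : ℕ) : 1 / 2 ≤ Real.log (ν k) := by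
  linarith [log_two_le_log_ν k, Real.log_two_gt_d9]

lemma log_le_of_le_pow_mul {A : ℝ} (hA : 1 ≤ A) {j k i : ℕ} (h : ν j ≤ A ^ i * ν k) :
    Real.log (ν j) ≤ (1 + 2 * i * Real.log A) * Real.log (ν k) := by
  have hA0 : 0 < A := by linarith
  have h1 : Real.log (ν j) ≤ i * Real.log A + Real.log (ν k) := by
    rw [← Real.log_pow, ← Real.log_mul (by positivity) (ν_pos k).ne']
    exact Real.log_le_log (ν_pos j) h
  have h2 := half_le_log_ν k
  have h3 : 0 ≤ (i : ℝ) * Real.log A := mul_nonneg (Nat.cast_nonneg _) (Real.log_nonneg hA)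
  nlinarith

/-- The bound `C * (u₁ * u₂ * u₃) ^ (1 / 4)` with `u = ν⁻¹ * log ν`; the factor belonging to `ν₄`
is bounded. -/
lemma abs_integral_prod_le_rpow_quarter {k : ℕ} : ∃ C : ℝ, 0 < C ∧ ∀ n : Fin (k + 4) → ℕ,
    |∫ t in Ioi 0, ∏ i, laguerreFun (n i) t| ≤
      C * (((ν (n 0))⁻¹ * Real.log (ν (n 0))) * ((ν (n 1))⁻¹ * Real.log (ν (n 1))) *
        ((ν (n 2))⁻¹ * Real.log (ν (n 2)))) ^ (1 / 4 : ℝ) := by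
  obtain ⟨C, hC, h⟩ := integral_laguerreFun_pow_four_le
  refine ⟨100 ^ k * C, by positivity, fun n => ?_⟩
  have hu : ∀ j, 0 < (ν j)⁻¹ * Real.log (ν j) := fun j =>
    mul_pos (inv_pos.2 (ν_pos j)) (log_ν_pos j)
  have hq : ∀ j, ((C * ((ν j)⁻¹ * Real.log (ν j))) ^ (1 / 4 : ℝ)) ^ 4 =
      C * ((ν j)⁻¹ * Real.log (ν j)) := by
    intro j
    rw [← Real.rpow_natCast, ← Real.rpow_mul (mul_pos hC (hu j)).le]; norm_num
  have hp : ∀ j, 0 < (C * ((ν j)⁻¹ * Real.log (ν j))) ^ (1 / 4 : ℝ) := fun j =>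
    Real.rpow_pos_of_pos (mul_pos hC (hu j)) _
  have h' : ∀ j, ∫ t in Ioi 0, laguerreFun j t ^ 4 ≤
    ((C * ((ν j)⁻¹ * Real.log (ν j))) ^ (1 / 4 : ℝ)) ^ 4 := fun j => (h j).trans (hq j).ge
  have hmain := abs_integral_prod_le_of_pow_four n (hp (n 0)) (hp (n 1)) (hp (n 2)) (hp (n 3))
    (h' _) (h' _) (h' _) (h' _)
  have hu1 : (ν (n 3))⁻¹ * Real.log (ν (n 3)) ≤ 1 := by
    rw [inv_mul_le_iff₀ (ν_pos _), mul_one]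
    linarith [Real.log_le_sub_one_of_pos (ν_pos (n 3))]
  have h4 : (C * ((ν (n 3))⁻¹ * Real.log (ν (n 3)))) ^ (1 / 4 : ℝ) ≤ C ^ (1 / 4 : ℝ) := by
    refine Real.rpow_le_rpow (mul_pos hC (hu _)).le ?_ (by norm_num)
    exact mul_le_of_le_one_right hC.le hu1
  have hC4 : C ^ (1 / 4 : ℝ) * C ^ (1 / 4 : ℝ) * C ^ (1 / 4 : ℝ) * C ^ (1 / 4 : ℝ) = C := by
    rw [← Real.rpow_add hC, ← Real.rpow_add hC, ← Real.rpow_add hC]; norm_num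
  refine hmain.trans ?_
  rw [Real.mul_rpow (mul_pos (hu _) (hu _)).le (hu _).le, Real.mul_rpow (hu _).le (hu _).le]
  calc _ ≤ 100 ^ k * ((C * ((ν (n 0))⁻¹ * Real.log (ν (n 0)))) ^ (1 / 4 : ℝ) *
        (C * ((ν (n 1))⁻¹ * Real.log (ν (n 1)))) ^ (1 / 4 : ℝ) *
        (C * ((ν (n 2))⁻¹ * Real.log (ν (n 2)))) ^ (1 / 4 : ℝ) * C ^ (1 / 4 : ℝ)) := by
        have := (hp (n 0)).le
        have := (hp (n 1)).le
        have := (hp (n 2)).le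
        gcongr
    _ = _ := by
        rw [Real.mul_rpow hC.le (hu _).le, Real.mul_rpow hC.le (hu _).le,
          Real.mul_rpow hC.le (hu _).le]
        linear_combination (100 ^ k * (((ν (n 0))⁻¹ * Real.log (ν (n 0))) ^ (1 / 4 : ℝ) *
          ((ν (n 1))⁻¹ * Real.log (ν (n 1))) ^ (1 / 4 : ℝ) *
          ((ν (n 2))⁻¹ * Real.log (ν (n 2))) ^ (1 / 4 : ℝ))) * hC4

/-- The exponential estimate settles the range `ν₁ / ν₂ ≳ log ν₁`. In the remaining range
`ν₂⁻¹ ≲ ν₁⁻¹ log ν₁`, so in Hölder's bound `(ν₁ ν₂ ν₃) ^ (-1 / 4) (log ν₁) ^ (3 / 4)` trading `ν₂`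
for `ν₁` costs exactly the remaining `(log ν₁) ^ (1 / 4)`. -/
theorem abs_integral_prod_le_log {k : ℕ} (A : ℝ) :
    ∃ C : ℝ, 0 < C ∧ ∀ n : Fin (k + 4) → ℕ, AlmostDecreasing A n →
      |∫ z in Ioi 0, ∏ i, laguerreFun (n i) z| ≤
        C * (ν (n 0) ^ (-(1 / 2) : ℝ) * ν (n 2) ^ (-(1 / 4) : ℝ) * Real.log (ν (n 0))) := by
  set A' := max A 1 with hA'
  have hA1 : 1 ≤ A' := le_max_right A 1
  have hA0 : 0 < A' := by linarith
  obtain ⟨C₁, c, hC₁, hc, hexp⟩ := abs_integral_prod_le_exp (m := k + 2) hA1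
  obtain ⟨C₂, hC₂, hquart⟩ := abs_integral_prod_le_rpow_quarter (k := k)
  set p : ℝ := ((k + 4 : ℕ) : ℝ) with hp
  have hp0 : 0 < p := by rw [hp]; positivity
  set Λ : ℝ := 1 + 4 * Real.log A' with hΛ
  have hlogA : 0 ≤ Real.log A' := Real.log_nonneg hA1
  have hΛ0 : 1 ≤ Λ := by rw [hΛ]; linarith
  refine ⟨C₁ * A' ^ (k + 3) * (2 * (A' ^ 2) ^ (1 / 4 : ℝ)) +
    C₂ * (p / c * Λ ^ 2) ^ (1 / 4 : ℝ), by positivity, fun n hn => ?_⟩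
  have hn' := hn.mono (le_max_left A 1)
  have hle1 : ν (n 1) ≤ A' ^ 1 * ν (n 0) := hn'.le_pow hA1 0 1 (by omega)
  have hle2 : ν (n 2) ≤ A' ^ 2 * ν (n 0) := hn'.le_pow hA1 0 2 (by omega)
  have hlog1 := log_le_of_le_pow_mul hA1 hle1
  have hlog2 := log_le_of_le_pow_mul hA1 hle2
  have hlog0 := half_le_log_ν (n 0)
  have hl1 := log_ν_pos (n 1)
  have hl2 := log_ν_pos (n 2)
  have h1 := hexp n hn'
  have h2 := hquart n
  change _ ≤ C₁ * ν (n 1) ^ (k + 2 + 1) * Real.exp (-(c * (ν (n 0) / ν (n 1)))) at h1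
  have b0 := two_le_ν (n 0)
  have b1 := ν_pos (n 1)
  have b2 := ν_pos (n 2)
  generalize ν (n 0) = ν₁ at *
  generalize ν (n 1) = ν₂ at *
  generalize ν (n 2) = ν₃ at *
  have b0' : 0 < ν₁ := by linarith
  set Lg := Real.log ν₁ with hLg
  have hLg0 : 0 < Lg := by linarith
  have hpos : 0 < ν₁ ^ (-(1 / 2) : ℝ) * ν₃ ^ (-(1 / 4) : ℝ) * Lg := by positivity
  rw [add_mul]
  by_cases hcase : p * Lg ≤ c * (ν₁ / ν₂)
  · -- widely separated frequencies: the exponential estimate wins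
    refine le_trans ?_ (le_add_of_nonneg_right (by positivity))
    have he : Real.exp (-(c * (ν₁ / ν₂))) ≤ (ν₁ ^ (k + 4))⁻¹ := by
      calc _ ≤ Real.exp (-(p * Lg)) := by gcongr
        _ = (ν₁ ^ (k + 4))⁻¹ := by
          rw [Real.exp_neg, hp, hLg, Real.exp_nat_mul, Real.exp_log b0']
    have h3 : ν₃ ^ (1 / 4 : ℝ) ≤ (A' ^ 2) ^ (1 / 4 : ℝ) * ν₁ ^ (1 / 4 : ℝ) := by
      rw [← Real.mul_rpow (by positivity) b0'.le]
      exact Real.rpow_le_rpow b2.le hle2 (by norm_num)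
    have h4 : ν₁⁻¹ ≤ 2 * (A' ^ 2) ^ (1 / 4 : ℝ) *
        (ν₁ ^ (-(1 / 2) : ℝ) * ν₃ ^ (-(1 / 4) : ℝ) * Lg) := by
      have h5 : ν₁⁻¹ * ν₁ ^ (1 / 4 : ℝ) ≤ ν₁ ^ (-(1 / 2) : ℝ) := by
        rw [← Real.rpow_neg_one, ← Real.rpow_add b0']
        exact Real.rpow_le_rpow_of_exponent_le (by linarith) (by norm_num)
      rw [Real.rpow_neg b2.le]
      have h6 : 0 < ν₃ ^ (1 / 4 : ℝ) := by positivity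
      calc ν₁⁻¹ = ν₁⁻¹ * ν₃ ^ (1 / 4 : ℝ) * (ν₃ ^ (1 / 4 : ℝ))⁻¹ := by field_simp
        _ ≤ ν₁⁻¹ * ((A' ^ 2) ^ (1 / 4 : ℝ) * ν₁ ^ (1 / 4 : ℝ)) * (ν₃ ^ (1 / 4 : ℝ))⁻¹ := by gcongr
        _ = (A' ^ 2) ^ (1 / 4 : ℝ) * (ν₁⁻¹ * ν₁ ^ (1 / 4 : ℝ)) * (ν₃ ^ (1 / 4 : ℝ))⁻¹ * 1 := by ring
        _ ≤ (A' ^ 2) ^ (1 / 4 : ℝ) * ν₁ ^ (-(1 / 2) : ℝ) * (ν₃ ^ (1 / 4 : ℝ))⁻¹ * (2 * Lg) := by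
            gcongr
            linarith
        _ = _ := by ring
    calc _ ≤ C₁ * ν₂ ^ (k + 2 + 1) * Real.exp (-(c * (ν₁ / ν₂))) := h1
      _ ≤ C₁ * (A' ^ 1 * ν₁) ^ (k + 2 + 1) * (ν₁ ^ (k + 4))⁻¹ := by gcongr
      _ = C₁ * A' ^ (k + 3) * ν₁⁻¹ := by
          rw [pow_one, mul_pow, show k + 2 + 1 = k + 3 by ring, pow_succ ν₁ (k + 3)]
          field_simp
      _ ≤ C₁ * A' ^ (k + 3) * (2 * (A' ^ 2) ^ (1 / 4 : ℝ) *
          (ν₁ ^ (-(1 / 2) : ℝ) * ν₃ ^ (-(1 / 4) : ℝ) * Lg)) := by gcongr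
      _ = _ := by ring
  · -- otherwise `ν₁ / ν₂` is at most logarithmic, and Hölder's inequality suffices
    refine le_trans ?_ (le_add_of_nonneg_left (by positivity))
    push Not at hcase
    have h3 : ν₂⁻¹ ≤ p / c * (Lg * ν₁⁻¹) := by
      have h4 : ν₁ / ν₂ ≤ p / c * Lg := by
        rw [div_mul_eq_mul_div, le_div_iff₀ hc]; linarith
      calc ν₂⁻¹ = ν₁ / ν₂ * ν₁⁻¹ := by field_simp
        _ ≤ p / c * Lg * ν₁⁻¹ := by gcongr
        _ = _ := by ring
    have h4 : Real.log ν₂ ≤ Λ * Lg := by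
      refine hlog1.trans ?_
      gcongr
      rw [hΛ]; push_cast; linarith
    have h5 : Real.log ν₃ ≤ Λ * Lg := by
      refine hlog2.trans ?_
      gcongr
      rw [hΛ]; push_cast; linarith
    have h6 : (ν₁⁻¹ * Lg) * (ν₂⁻¹ * Real.log ν₂) * (ν₃⁻¹ * Real.log ν₃) ≤
        (p / c * Λ ^ 2) * ((ν₁ ^ (-(1 / 2) : ℝ)) ^ 4 * (ν₃ ^ (-(1 / 4) : ℝ)) ^ 4 * Lg ^ 4) := by
      have e1 : (ν₁ ^ (-(1 / 2) : ℝ)) ^ 4 = ν₁⁻¹ * ν₁⁻¹ := by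
        rw [← Real.rpow_natCast, ← Real.rpow_mul b0'.le, ← Real.rpow_neg_one,
          ← Real.rpow_add b0']; norm_num
      have e2 : (ν₃ ^ (-(1 / 4) : ℝ)) ^ 4 = ν₃⁻¹ := by
        rw [← Real.rpow_natCast, ← Real.rpow_mul b2.le, ← Real.rpow_neg_one]; norm_num
      rw [e1, e2]
      calc _ ≤ (ν₁⁻¹ * Lg) * (p / c * (Lg * ν₁⁻¹) * (Λ * Lg)) * (ν₃⁻¹ * (Λ * Lg)) := by gcongr
        _ = _ := by ring
    refine h2.trans ?_
    rw [mul_assoc C₂ ((p / c * Λ ^ 2) ^ (1 / 4 : ℝ))]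
    refine mul_le_mul_of_nonneg_left ?_ hC₂.le
    calc _ ≤ ((p / c * Λ ^ 2) * ((ν₁ ^ (-(1 / 2) : ℝ)) ^ 4 * (ν₃ ^ (-(1 / 4) : ℝ)) ^ 4 *
          Lg ^ 4)) ^ (1 / 4 : ℝ) := Real.rpow_le_rpow (by positivity) h6 (by norm_num)
      _ = _ := by
        rw [Real.mul_rpow (by positivity) (by positivity), ← mul_pow, ← mul_pow,
          ← Real.rpow_natCast (_ * _ * _) 4, ← Real.rpow_mul hpos.le]
        norm_num

end RadialHermite

theorem mainTheorem6 :
    (∀ q : ENNReal, 2 ≤ q → q ≠ 4 →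
      ∃ C : ℝ, 0 < C ∧ ∀ k : ℕ,
        MeasureTheory.eLpNorm (RadialHermite.e k) q MeasureTheory.volume ≤
          ENNReal.ofReal (C * RadialHermite.ν k ^ (-RadialHermite.ρ q))) ∧
    (∃ C : ℝ, 0 < C ∧ ∀ k : ℕ,
      MeasureTheory.eLpNorm (RadialHermite.e k) 4 MeasureTheory.volume ≤
        ENNReal.ofReal (C * RadialHermite.ν k ^ (-(1 / 4) : ℝ) *
          Real.log (RadialHermite.ν k) ^ (1 / 4 : ℝ))) ∧
    (∀ (l : ℕ) (hl : 4 ≤ l),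
      (∀ n : Fin l → ℕ, MeasureTheory.Integrable
        (fun x : EuclideanSpace ℝ (Fin 2) => ∏ i, RadialHermite.e (n i) x)
        MeasureTheory.volume) ∧
      (∀ A : ℝ, 0 < A →
        ∃ C : ℝ, 0 < C ∧ ∀ n : Fin l → ℕ, RadialHermite.AlmostDecreasing A n →
          |∫ x : EuclideanSpace ℝ (Fin 2), ∏ i, RadialHermite.e (n i) x| ≤
            C * RadialHermite.ν (n ⟨0, by omega⟩) ^ (-(1 / 2) : ℝ) *
              RadialHermite.ν (n ⟨2, by omega⟩) ^ (-(1 / 4) : ℝ) *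
              Real.log (RadialHermite.ν (n ⟨0, by omega⟩))) ∧
      (∀ A : ℝ, 0 < A → ∀ B : ℝ, 0 < B → ∀ ε : ℝ, 0 < ε → ∀ N : ℝ, 0 < N →
        ∃ C : ℝ, 0 < C ∧ ∀ n : Fin l → ℕ, RadialHermite.AlmostDecreasing A n →
          RadialHermite.ν (n ⟨1, by omega⟩) ^ (1 + ε) ≤
            B * RadialHermite.ν (n ⟨0, by omega⟩) →
          |∫ x : EuclideanSpace ℝ (Fin 2), ∏ i, RadialHermite.e (n i) x| ≤
            C * RadialHermite.ν (n ⟨0, by omega⟩) ^ (-N))) := by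
  refine ⟨RadialHermite.eLpNorm_e_le_of_ne_four, RadialHermite.eLpNorm_e_four_le, fun l hl => ?_⟩
  obtain ⟨k, rfl⟩ := Nat.exists_eq_add_of_le' hl
  have hpi := Real.pi_pos
  refine ⟨fun n => RadialHermite.integrable_prod_e n, fun A _ => ?_,
    fun A _ B hB ε hε N _ => ?_⟩
  · obtain ⟨C, hC, h⟩ := RadialHermite.abs_integral_prod_le_log (k := k) A
    refine ⟨Real.pi * C, by positivity, fun n hn => ?_⟩
    refine (RadialHermite.abs_integral_prod_e_le n).trans
      ((mul_le_mul_of_nonneg_left (h n hn) hpi.le).trans (le_of_eq ?_))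
    rw [← mul_assoc, ← mul_assoc, ← mul_assoc]
    rfl
  · obtain ⟨C, hC, h⟩ := RadialHermite.abs_integral_prod_le_rpow_neg (m := k + 2) (A := A) hB hε N
    refine ⟨Real.pi * C, by positivity, fun n hn hsep => ?_⟩
    refine (RadialHermite.abs_integral_prod_e_le n).trans
      ((mul_le_mul_of_nonneg_left (h n hn hsep) hpi.le).trans (le_of_eq ?_))
    rw [← mul_assoc]
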